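/- Let $0<k<n$ be integers, let $V=\mathbb C^n$, and let $\mathrm{Gr}(k,V)$ be the Grassmannian of $k$-dimensional linear subspaces of $V$, a projective variety (with its Zariski topology) through the Plücker embedding. A Schubert condition on $\mathrm{Gr}(k,V)$ is a list $\alpha=(\alpha_1<\dots<\alpha_k)$ of elements of $\{1,\dots,n\}$; put $|\alpha|:=k(n-k)-\sum_{i=1}^k(\alpha_i-i)$. Let $\gamma=(\gamma_1,\dots,\gamma_n)$ be a parametrized rational normal curve, that is, $\gamma_1(s,t),\dots,\gamma_n(s,t)$ is a basis of the space of complex binary forms of degree $n-1$. For $a\in\mathbb P^1=\mathbb C\cup\{\infty\}$, where $a\in\mathbb C$ stands for the point $(s,t)=(1,a)$ and $\infty$ for $(0,1)$, and for $0\le i\le n$, let $F_i(a)\subseteq V$ be the span of $\gamma(a),\gamma'(a),\dots,\gamma^{(i-1)}(a)$, the derivatives being those of $x\mapsto\gamma(1,x)$ at $x=a$ if $a\in\mathbb C$, and those of $x\mapsto\gamma(x,1)$ at $x=0$ if $a=\infty$. The osculating Schubert variety of $\alpha$ at $a$ is $$X_\alpha(a):=\{H\in\mathrm{Gr}(k,V)\mid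 \dim(H\cap F_{\alpha_i}(a))\ge i\ \text{ for } i=1,\dots,k\}.$$ **Theorem (Eisenbud–Harris).** Let $\alpha^1,\dots,\alpha^m$ be Schubert conditions on $\mathrm{Gr}(k,V)$ and let $a_1,\dots,a_m\in\mathbb P^1$ be distinct points. If the intersection $$X:=X_{\alpha^1}(a_1)\cap\dots\cap X_{\alpha^m}(a_m)$$ is nonempty, then its codimension $\operatorname{codim}(X):=\dim\mathrm{Gr}(k,V)-\dim X$ is exactly $|\alpha^1|+\dots+|\alpha^m|$. -/

import Mathlib

noncomputable section

namespace OscSchubert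

open MvPolynomial

/-- The Grassmannian `Gr(k, V)`, `V = ℂⁿ`: the `k`-dimensional linear subspaces of `ℂⁿ`. -/
def Gr (k n : ℕ) : Type :=
  {H : Submodule ℂ (Fin n → ℂ) // Module.finrank ℂ H = k}

/-- The row space of a `k × n` matrix. -/
def rowSpace {k n : ℕ} (M : Matrix (Fin k) (Fin n) ℂ) : Submodule ℂ (Fin n → ℂ) :=
  Submodule.span ℂ (Set.range fun i : Fin k => M i)

/-- The vector of maximal minors of a `k × n` matrix, indexed by the increasing lists of `k`
columns. If the row space of `M` is the `k`-plane `H`, these are the Plücker coordinates of `H`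
(which are well defined up to a common nonzero factor). -/
def maxMinors {k n : ℕ} (M : Matrix (Fin k) (Fin n) ℂ) : (Fin k ↪o Fin n) → ℂ :=
  fun β => (M.submatrix id β).det

/-- The set of `k`-planes at which `p`, a polynomial in the Plücker coordinates, does not vanish.
It is used for homogeneous `p` only, and then the choice of the matrix `M` representing `H` is
irrelevant. -/
def Gr.nonvanishing {k n : ℕ} (p : MvPolynomial (Fin k ↪o Fin n) ℂ) : Set (Gr k n) :=
  {H | ∃ M : Matrix (Fin k) (Fin n) ℂ, rowSpace M = H.1 ∧ eval (maxMinors M) p ≠ 0}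

/-- The Zariski topology of `Gr(k, V)` as a projective variety in Plücker space: the principal open
sets `p ≠ 0`, for `p` a homogeneous polynomial in the Plücker coordinates, form a basis. -/
instance Gr.zariskiTopology (k n : ℕ) : TopologicalSpace (Gr k n) :=
  TopologicalSpace.generateFrom
    {U | ∃ (d : ℕ) (p : MvPolynomial (Fin k ↪o Fin n) ℂ),
      p.IsHomogeneous d ∧ U = Gr.nonvanishing p}

/-- `X` is of codimension `c` in `Gr(k, V)`: `X` and `Gr(k, V)` have finite (Krull) dimensions in
the Zariski topology, `X` is not empty, and `dim Gr(k, V) - dim X = c`.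
(The Krull dimension of the empty space is `⊥`.) -/
def HasCodim {k n : ℕ} (X : Set (Gr k n)) (c : ℕ) : Prop :=
  ∃ d : ℕ, topologicalKrullDim X = (d : WithBot ℕ∞) ∧
    topologicalKrullDim (Gr k n) = ((d + c : ℕ) : WithBot ℕ∞)

/-- A Schubert condition on `Gr(k, V)`: a list `α₁ < ⋯ < α_k` in `{1, …, n}`. As `Fin n` starts
at `0`, the number `αᵢ` of the list, for `1 ≤ i ≤ k`, is `α (i - 1) + 1`. -/
abbrev SchubertCondition (k n : ℕ) : Type := Fin k ↪o Fin n

/-- `|α| = k (n - k) - ∑ᵢ (αᵢ - i)`. No subtraction here is truncated when `k ≤ n`, since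
`0 ≤ αᵢ - i ≤ n - k`. The shifts of `αᵢ` and of `i` by one cancel. -/
def SchubertCondition.size {k n : ℕ} (α : SchubertCondition k n) : ℕ :=
  k * (n - k) - ∑ i : Fin k, ((α i : ℕ) - (i : ℕ))

/-- The Schubert variety `{H | dim (H ∩ F_{αᵢ}) ≥ i for i = 1, …, k}`, where `F i` is the
`i`-dimensional subspace of a flag. -/
def schubertVariety {k n : ℕ} (α : SchubertCondition k n)
    (F : ℕ → Submodule ℂ (Fin n → ℂ)) : Set (Gr k n) :=
  {H | ∀ i : Fin k,
    (i : ℕ) + 1 ≤ Module.finrank ℂ (H.1 ⊓ F ((α i : ℕ) + 1) : Submodule ℂ (Fin n → ℂ))}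

/-- A parametrized rational normal curve `γ(s, t) = (γ₁(s, t), …, γₙ(s, t))`: a basis of the space
of binary forms of degree `n - 1`. The variables `s` and `t` are `X 0` and `X 1`. -/
abbrev RationalNormalCurve (n : ℕ) : Type :=
  Module.Basis (Fin n) ℂ (homogeneousSubmodule (Fin 2) ℂ (n - 1))

/-- The coordinates of a rational normal curve as polynomials in a local parameter at a point
of `ℙ¹ = ℂ ∪ {∞}`: `γ(1, x)` at the points of `ℂ`, and `γ(x, 1)` at `∞`. -/
def RationalNormalCurve.localParam {n : ℕ} (γ : RationalNormalCurve n) :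
    OnePoint ℂ → Fin n → Polynomial ℂ
  | some _ => fun j => aeval ![1, Polynomial.X] (γ j : MvPolynomial (Fin 2) ℂ)
  | none => fun j => aeval ![Polynomial.X, 1] (γ j : MvPolynomial (Fin 2) ℂ)

/-- The value of the local parameter at the point: `t ∈ ℂ` is the point `(1, t)`, and `∞` is
the point `(0, 1)`. -/
def localValue : OnePoint ℂ → ℂ
  | some t => t
  | none => 0

/-- The derivative `γ^{(r)}(a) ∈ ℂⁿ` with respect to the local parameter at `a ∈ ℙ¹`. -/
def RationalNormalCurve.deriv {n : ℕ} (γ : RationalNormalCurve n) (r : ℕ) (a : OnePoint ℂ) :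
    Fin n → ℂ :=
  fun j => (Polynomial.derivative^[r] (γ.localParam a j)).eval (localValue a)

/-- The osculating flag: `F_i(a)` is the span of `γ(a), γ'(a), …, γ^{(i-1)}(a)`. -/
def RationalNormalCurve.osculatingFlag {n : ℕ} (γ : RationalNormalCurve n) (a : OnePoint ℂ)
    (i : ℕ) : Submodule ℂ (Fin n → ℂ) :=
  Submodule.span ℂ (Set.range fun r : Fin i => γ.deriv r a)

/-- The osculating Schubert variety `X_α(a)`. -/
def osculatingSchubertVariety {k n : ℕ} (γ : RationalNormalCurve n) (α : SchubertCondition k n)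
    (a : OnePoint ℂ) : Set (Gr k n) :=
  schubertVariety α (γ.osculatingFlag a)

end OscSchubert

end

/-! ### Plücker coordinates, the Zariski topology and Schubert varieties. -/

noncomputable section
namespace OscSchubert
open MvPolynomial

variable {k n : ℕ}

/-! The two bounds on `dim X` have independent proofs.

Upper bound (`length_add_sum_size_le`). The linear map `toPoly`, which sends γ(s,t) to (t -
sX)^(n-1), identifies ℂⁿ with the polynomials of degree < n. It turns F_i(a) into the polynomials
divisible by (X - a)^(n-i), and F_i(∞) into those of degree < i. The Wronskian of a k-plane H is a
nonzero polynomial of degree at most k(n-k), well defined up to a constant. If H lies in X_α(a), it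
vanishes at a to order at least |α|; if a = ∞, the bound on its degree drops by |α|. For distinct
points these conditions add up. Vanishing of the Wronskian at a further point is a hyperplane
section in Plücker space. In a chain of length d of irreducible closed sets, the largest member
meets any d hyperplanes (`exists_mem_last_forall_notMem_nonvanishing`). Hence, if it lies in X, some
H in X has a Wronskian with d further roots, and d + ∑|αⁱ| ≤ k(n-k).

Lower bound (`exists_ltSeries_irreducibleCloseds`). Families of matrices whose i-th row space lies
in X_{αⁱ}(a_i) are parametrized by products G·A·E with A in echelon form. The closure of the image
is irreducible of dimension at least m·kn - ∑|αⁱ|. A point of X gives a point of this closure on the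
diagonal. The diagonal costs (m-1)kn equations, and the normalization M·D = 1, which selects one
matrix for each k-plane, costs k² more. Each equation lowers the dimension at the point by at most
one, so a chain of length at least k(n-k) - ∑|αⁱ| remains in X. -/

theorem det_one_submatrix_orderEmb (β δ : Fin k ↪o Fin n) :
    ((1 : Matrix (Fin n) (Fin n) ℂ).submatrix δ β).det = if δ = β then 1 else 0 := by
  split_ifs with h
  · subst h
    rw [Matrix.submatrix_one _ δ.injective, Matrix.det_one]
  · obtain ⟨j, hj⟩ : ∃ j, β j ∉ Set.range δ := by
      by_contra! hc
      refine h (OrderEmbedding.range_inj.1 ?_).symm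
      refine Set.eq_of_subset_of_ncard_le (Set.range_subset_iff.2 hc) ?_ (Set.toFinite _)
      rw [← Set.image_univ, ← Set.image_univ, Set.ncard_image_of_injective _ δ.injective,
        Set.ncard_image_of_injective _ β.injective]
    refine Matrix.det_eq_zero_of_column_eq_zero j fun i => ?_
    rw [Matrix.submatrix_apply, Matrix.one_apply_ne]
    exact fun e => hj ⟨i, e⟩

/-- The Cauchy–Binet formula. -/
theorem det_mul_eq_sum (M : Matrix (Fin k) (Fin n) ℂ) (D : Matrix (Fin n) (Fin k) ℂ) :
    (M * D).det = ∑ β : Fin k ↪o Fin n, (D.submatrix β id).det * maxMinors M β := by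
  let f : (Fin n → ℂ) [⋀^Fin k]→ₗ[ℂ] ℂ :=
    Matrix.detRowAlternating.compLinearMap (Matrix.vecMulLinear D)
  let g : (Fin n → ℂ) [⋀^Fin k]→ₗ[ℂ] ℂ := ∑ β : Fin k ↪o Fin n,
    (D.submatrix β id).det • Matrix.detRowAlternating.compLinearMap (LinearMap.funLeft ℂ ℂ β)
  have hf : ∀ M : Matrix (Fin k) (Fin n) ℂ, f M = (M * D).det := fun M => rfl
  have hg : ∀ M : Matrix (Fin k) (Fin n) ℂ,
      g M = ∑ β : Fin k ↪o Fin n, (D.submatrix β id).det * maxMinors M β := fun M => by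
    let ev : ((Fin n → ℂ) [⋀^Fin k]→ₗ[ℂ] ℂ) →+ ℂ :=
      { toFun := fun h => h M, map_zero' := rfl, map_add' := fun _ _ => rfl }
    exact map_sum ev _ _
  rw [← hf, ← hg]
  refine congrArg (fun h : (Fin n → ℂ) [⋀^Fin k]→ₗ[ℂ] ℂ => h M) ?_
  -- Both sides are alternating in the rows, so distinct standard basis vectors suffice as rows.
  -- Their indices `v` are an increasing list `β₀` composed with a permutation `σ`.
  refine Module.Basis.ext_alternating (Pi.basisFun ℂ (Fin n)) fun v hv => ?_
  have hrow : (fun i => Pi.basisFun ℂ (Fin n) (v i))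
      = (1 : Matrix (Fin n) (Fin n) ℂ).submatrix v id := by
    funext i j
    simp [Matrix.one_apply, Pi.single_apply, eq_comm]
  rw [hrow]
  refine (hf _).trans (Eq.trans ?_ (hg _).symm)
  have hcard : (Finset.univ.image v).card = k := by
    rw [Finset.card_image_of_injective _ hv, Finset.card_univ, Fintype.card_fin]
  let β₀ := (Finset.univ.image v).orderEmbOfFin hcard
  let e := (Finset.univ.image v).orderIsoOfFin hcard
  let τ : Fin k → Fin k := fun i => e.symm ⟨v i, Finset.mem_image_of_mem v (Finset.mem_univ i)⟩
  have hτ : ∀ i, β₀ (τ i) = v i := fun i => by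
    simp only [β₀, τ, ← Finset.coe_orderIsoOfFin_apply]
    exact congrArg Subtype.val (e.apply_symm_apply _)
  have hτi : Function.Injective τ := fun i j hij => hv (by rw [← hτ i, ← hτ j, hij])
  let σ : Equiv.Perm (Fin k) := Equiv.ofBijective τ (Finite.injective_iff_bijective.1 hτi)
  have hv' : v = β₀ ∘ σ := funext fun i => (hτ i).symm
  have h1 : ∀ β : Fin k ↪o Fin n, maxMinors ((1 : Matrix (Fin n) (Fin n) ℂ).submatrix v id) β
      = (Equiv.Perm.sign σ : ℂ) * if β₀ = β then 1 else 0 := fun β => by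
    rw [← det_one_submatrix_orderEmb, ← Matrix.det_permute, hv']
    rfl
  simp only [h1, mul_ite, mul_one, mul_zero, Finset.sum_ite_eq, Finset.mem_univ, if_true]
  rw [mul_comm, ← Matrix.det_permute, hv']
  congr 1
  ext i j
  simp [Matrix.mul_apply, Matrix.one_apply]

/-- The linear form in the Plücker coordinates whose value at a matrix `M` is `det (M * D)`. -/
def pluckerForm (D : Matrix (Fin n) (Fin k) ℂ) : MvPolynomial (Fin k ↪o Fin n) ℂ :=
  ∑ β : Fin k ↪o Fin n, C (D.submatrix β id).det * X β

theorem isHomogeneous_pluckerForm (D : Matrix (Fin n) (Fin k) ℂ) :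
    (pluckerForm D).IsHomogeneous 1 :=
  IsHomogeneous.sum _ _ _ fun β _ => by
    simpa using (isHomogeneous_C (Fin k ↪o Fin n) (D.submatrix β id).det).mul (isHomogeneous_X ℂ β)

theorem eval_pluckerForm (D : Matrix (Fin n) (Fin k) ℂ) (M : Matrix (Fin k) (Fin n) ℂ) :
    eval (maxMinors M) (pluckerForm D) = (M * D).det := by
  simp [pluckerForm, det_mul_eq_sum]

theorem pluckerForm_one_submatrix (γ : Fin k ↪o Fin n) :
    pluckerForm ((1 : Matrix (Fin n) (Fin n) ℂ).submatrix id γ) = X γ := by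
  have h : ∀ β : Fin k ↪o Fin n,
      (((1 : Matrix (Fin n) (Fin n) ℂ).submatrix id γ).submatrix β id).det
        = if β = γ then 1 else 0 := fun β => det_one_submatrix_orderEmb γ β
  simp only [pluckerForm, h]
  simp [apply_ite C, ite_mul]

theorem exists_rowSpace_eq (H : Gr k n) : ∃ M : Matrix (Fin k) (Fin n) ℂ, rowSpace M = H.1 := by
  let b := Module.finBasisOfFinrankEq ℂ H.1 H.2
  refine ⟨fun i => (b i : Fin n → ℂ), ?_⟩
  have := congrArg (Submodule.map H.1.subtype) b.span_eq
  rwa [Submodule.map_span, Submodule.map_top, Submodule.range_subtype, ← Set.range_comp] at this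

theorem linearIndependent_of_rowSpace {M : Matrix (Fin k) (Fin n) ℂ} {H : Gr k n}
    (h : rowSpace M = H.1) : LinearIndependent ℂ M.row := by
  rw [linearIndependent_iff_card_eq_finrank_span, Fintype.card_fin]
  exact (H.2.symm.trans (by rw [← h]; rfl))

theorem finrank_rowSpace {M : Matrix (Fin k) (Fin n) ℂ} (h : LinearIndependent ℂ M.row) :
    Module.finrank ℂ (rowSpace M) = k := by
  have := finrank_span_eq_card h
  rwa [Fintype.card_fin] at this

theorem exists_rightInverse {M : Matrix (Fin k) (Fin n) ℂ} (h : LinearIndependent ℂ M.row) :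
    ∃ D : Matrix (Fin n) (Fin k) ℂ, M * D = 1 := by
  have hinj : Function.Injective (Matrix.vecMulLinear M) := Matrix.vecMul_injective_iff.2 h
  obtain ⟨g, hg⟩ := LinearMap.exists_leftInverse_of_injective _ (LinearMap.ker_eq_bot.2 hinj)
  refine ⟨(LinearMap.toMatrix' g).transpose, ?_⟩
  refine Matrix.ext_of_single_vecMul fun i => ?_
  rw [← Matrix.vecMul_vecMul, Matrix.vecMul_transpose, LinearMap.toMatrix'_mulVec,
    Matrix.vecMul_one]
  exact LinearMap.congr_fun hg _

theorem linearIndependent_of_det_mul_ne_zero {M : Matrix (Fin k) (Fin n) ℂ}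
    {D : Matrix (Fin n) (Fin k) ℂ} (h : (M * D).det ≠ 0) : LinearIndependent ℂ M.row := by
  refine Matrix.vecMul_injective_iff.1 fun x y hxy => ?_
  refine Matrix.vecMul_injective_of_isUnit ((Matrix.isUnit_iff_isUnit_det _).2 h.isUnit) ?_
  simp only [← Matrix.vecMul_vecMul]
  exact congrArg (fun v => Matrix.vecMul v D) hxy

theorem exists_eq_mul_of_rowSpace_le {M M' : Matrix (Fin k) (Fin n) ℂ}
    (h : rowSpace M' ≤ rowSpace M) : ∃ g : Matrix (Fin k) (Fin k) ℂ, M' = g * M := by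
  have h1 : ∀ i, ∃ c : Fin k → ℂ, ∑ j, c j • M j = M' i := fun i =>
    (Submodule.mem_span_range_iff_exists_fun ℂ).1 (h (Submodule.subset_span ⟨i, rfl⟩))
  choose g hg using h1
  refine ⟨Matrix.of g, ?_⟩
  ext i s
  simp [← hg i, Matrix.mul_apply]

theorem rowSpace_mul_le (g : Matrix (Fin k) (Fin k) ℂ) (M : Matrix (Fin k) (Fin n) ℂ) :
    rowSpace (g * M) ≤ rowSpace M := by
  refine Submodule.span_le.2 ?_
  rintro _ ⟨i, rfl⟩
  simp only [SetLike.mem_coe]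
  rw [Matrix.mul_apply_eq_vecMul, Matrix.vecMul_eq_sum]
  exact Submodule.sum_mem _ fun j _ => Submodule.smul_mem _ _ (Submodule.subset_span ⟨j, rfl⟩)

theorem exists_eq_mul_of_rowSpace_eq {M M' : Matrix (Fin k) (Fin n) ℂ} {H : Gr k n}
    (h : rowSpace M = H.1) (h' : rowSpace M' = H.1) :
    ∃ g : Matrix (Fin k) (Fin k) ℂ, g.det ≠ 0 ∧ M' = g * M := by
  obtain ⟨g, hg⟩ := exists_eq_mul_of_rowSpace_le (h'.trans h.symm).le
  refine ⟨g, fun h0 => ?_, hg⟩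
  obtain ⟨D, hD⟩ := exists_rightInverse (linearIndependent_of_rowSpace h')
  rw [hg, Matrix.mul_assoc] at hD
  simpa [h0] using congrArg Matrix.det hD

theorem maxMinors_mul (g : Matrix (Fin k) (Fin k) ℂ) (M : Matrix (Fin k) (Fin n) ℂ) :
    maxMinors (g * M) = g.det • maxMinors M := by
  funext β
  simp only [maxMinors, Pi.smul_apply, smul_eq_mul, ← Matrix.det_mul]
  congr 1

theorem eval_smul_of_isHomogeneous {σ : Type*} {p : MvPolynomial σ ℂ} {d : ℕ}
    (hp : p.IsHomogeneous d) (c : ℂ) (x : σ → ℂ) : eval (c • x) p = c ^ d * eval x p := by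
  rw [eval_eq, eval_eq, Finset.mul_sum]
  refine Finset.sum_congr rfl fun m hm => ?_
  have hd : ∑ i ∈ m.support, m i = d := by
    have := hp (mem_support_iff.1 hm)
    rwa [Finsupp.weight_apply, Finsupp.sum, Finset.sum_congr rfl fun i _ => by
      rw [Pi.one_apply, smul_eq_mul, mul_one]] at this
  simp only [Pi.smul_apply, smul_eq_mul, mul_pow, Finset.prod_mul_distrib,
    Finset.prod_pow_eq_pow_sum, hd]
  ring

theorem Gr.mem_nonvanishing_iff {p : MvPolynomial (Fin k ↪o Fin n) ℂ} {d : ℕ}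
    (hp : p.IsHomogeneous d) {H : Gr k n} {M : Matrix (Fin k) (Fin n) ℂ}
    (hM : rowSpace M = H.1) : H ∈ Gr.nonvanishing p ↔ eval (maxMinors M) p ≠ 0 := by
  refine ⟨?_, fun h => ⟨M, hM, h⟩⟩
  rintro ⟨M', hM', h⟩ h0
  obtain ⟨g, -, rfl⟩ := exists_eq_mul_of_rowSpace_eq hM hM'
  rw [maxMinors_mul, eval_smul_of_isHomogeneous hp, h0, mul_zero] at h
  exact h rfl

theorem Gr.isOpen_nonvanishing {p : MvPolynomial (Fin k ↪o Fin n) ℂ} {d : ℕ}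
    (hp : p.IsHomogeneous d) : IsOpen (Gr.nonvanishing p) :=
  TopologicalSpace.isOpen_generateFrom_of_mem ⟨d, p, hp, rfl⟩

/-- Products of homogeneous polynomials are homogeneous, so the generating sets are stable under
intersection and form a basis up to the whole space. -/
theorem Gr.exists_nonvanishing_subset {U : Set (Gr k n)} (hU : IsOpen U) {H : Gr k n}
    (hH : H ∈ U) : ∃ (d : ℕ) (p : MvPolynomial (Fin k ↪o Fin n) ℂ),
      p.IsHomogeneous d ∧ H ∈ Gr.nonvanishing p ∧ Gr.nonvanishing p ⊆ U := by
  have hb := TopologicalSpace.isTopologicalBasis_of_subbasis_of_inter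
    (t := Gr.zariskiTopology k n) rfl (by
      rintro _ ⟨d, p, hp, rfl⟩ _ ⟨e, q, hq, rfl⟩
      refine ⟨d + e, p * q, hp.mul hq, ?_⟩
      ext H
      obtain ⟨M, hM⟩ := exists_rowSpace_eq H
      rw [Set.mem_inter_iff, mem_nonvanishing_iff hp hM, mem_nonvanishing_iff hq hM,
        mem_nonvanishing_iff (hp.mul hq) hM, map_mul, mul_ne_zero_iff])
  obtain ⟨V, hV, hHV, hVU⟩ := hb.exists_subset_of_mem_open hH hU
  rcases hV with rfl | ⟨d, p, hp, rfl⟩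
  · obtain ⟨M, hM⟩ := exists_rowSpace_eq H
    exact ⟨0, 1, isHomogeneous_one _ _, ⟨M, hM, by simp⟩, (Set.subset_univ _).trans hVU⟩
  · exact ⟨d, p, hp, hHV, hVU⟩

/-- Take for `D` a projection onto `H` whose kernel contains a complement of `H ⊓ F` in `F`. It is
the identity on `H`, and the image of `F` is no larger than `H ⊓ F`. -/
theorem exists_det_ne_zero_of_finrank_inf_le {H F : Submodule ℂ (Fin n → ℂ)} {i : ℕ}
    {M : Matrix (Fin k) (Fin n) ℂ} (hM : rowSpace M = H) (hli : LinearIndependent ℂ M.row)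
    (hi : Module.finrank ℂ (H ⊓ F : Submodule ℂ (Fin n → ℂ)) ≤ i) :
    ∃ D : Matrix (Fin n) (Fin k) ℂ, (M * D).det ≠ 0 ∧
      Module.finrank ℂ (F.map (Matrix.vecMulLinear D)) ≤ i := by
  obtain ⟨c, hc⟩ := Submodule.exists_isCompl (H ⊓ F)
  have hF : F = (H ⊓ F) ⊔ (c ⊓ F) := by
    rw [← sup_inf_assoc_of_le c inf_le_right, hc.sup_eq_top, top_inf_eq]
  have hdisj : Disjoint (c ⊓ F) H := by
    rw [disjoint_iff, ← hc.inf_eq_bot]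
    refine le_antisymm ?_ ?_
    · exact le_inf (le_inf inf_le_right (inf_le_left.trans inf_le_right))
        (inf_le_left.trans inf_le_left)
    · rw [hc.inf_eq_bot]
      exact bot_le
  obtain ⟨G, hG, hcompl⟩ := hdisj.exists_isCompl
  let b : Module.Basis (Fin k) ℂ H :=
    (Module.Basis.span hli).map (LinearEquiv.ofEq _ _ hM)
  have hb : ∀ j, (b j : Fin n → ℂ) = M j := fun j => by
    simp only [b, Module.Basis.map_apply]
    exact congrArg Subtype.val (Module.Basis.span_apply hli j)
  let φ : (Fin n → ℂ) →ₗ[ℂ] (Fin k → ℂ) :=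
    b.equivFun.toLinearMap ∘ₗ Submodule.projectionOnto H G hcompl.symm
  let D := (LinearMap.toMatrix' φ).transpose
  have hD : Matrix.vecMulLinear D = φ := LinearMap.ext fun v => by
    simp only [D, Matrix.vecMulLinear_apply, Matrix.vecMul_transpose, LinearMap.toMatrix'_mulVec]
  refine ⟨D, ?_, ?_⟩
  · have : M * D = 1 := by
      funext j
      rw [Matrix.mul_apply_eq_vecMul, ← Matrix.vecMulLinear_apply, hD]
      simp only [φ, LinearMap.comp_apply, LinearEquiv.coe_coe]
      rw [← hb j, Submodule.projectionOnto_apply_left, b.equivFun_apply, b.repr_self]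
      funext l
      simp [Matrix.one_apply, Finsupp.single_apply]
    simp [this]
  · rw [hD, hF, Submodule.map_sup]
    have h0 : (c ⊓ F).map φ = ⊥ := by
      rw [eq_bot_iff, Submodule.map_le_iff_le_comap]
      intro v hv
      simp only [Submodule.mem_comap, Submodule.mem_bot, φ, LinearMap.comp_apply, LinearEquiv.coe_coe]
      rw [(Submodule.projectionOnto_apply_eq_zero_iff _).2 (hG hv), map_zero]
    rw [h0, sup_bot_eq]
    exact (Submodule.finrank_map_le _ _).trans hi

/-- By dimension, `D` kills a nonzero vector of `H ⊓ F`, hence one of the row space. -/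
theorem det_mul_eq_zero_of_finrank_map_lt {H F : Submodule ℂ (Fin n → ℂ)}
    {M : Matrix (Fin k) (Fin n) ℂ} (hM : rowSpace M = H) {D : Matrix (Fin n) (Fin k) ℂ}
    (h : Module.finrank ℂ (F.map (Matrix.vecMulLinear D)) <
      Module.finrank ℂ (H ⊓ F : Submodule ℂ (Fin n → ℂ))) : (M * D).det = 0 := by
  let φ := (Matrix.vecMulLinear D).domRestrict (H ⊓ F)
  have hφ : LinearMap.ker φ ≠ ⊥ := fun hk => by
    have h1 := LinearMap.finrank_range_of_inj (LinearMap.ker_eq_bot.1 hk)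
    have h2 : LinearMap.range φ ≤ F.map (Matrix.vecMulLinear D) := by
      rintro _ ⟨v, rfl⟩
      exact ⟨v, v.2.2, rfl⟩
    exact absurd (Submodule.finrank_mono h2) (by rw [h1]; exact not_le.2 h)
  obtain ⟨v, hv, hv0⟩ := Submodule.exists_mem_ne_zero_of_ne_bot hφ
  have hvM : (v : Fin n → ℂ) ∈ rowSpace M := hM ▸ v.2.1
  obtain ⟨c, hc⟩ := (Submodule.mem_span_range_iff_exists_fun ℂ).1 hvM
  refine Matrix.exists_vecMul_eq_zero_iff.1 ⟨c, ?_, ?_⟩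
  · rintro rfl
    exact hv0 (Subtype.ext (by rw [← hc]; simp))
  · have h1 : Matrix.vecMul c M = v := (Matrix.vecMul_eq_sum c M).trans hc
    rw [← Matrix.vecMul_vecMul, h1]
    exact hv

/-- A point outside a Schubert variety is separated from it by a linear form in the Plücker
coordinates. -/
theorem exists_det_of_notMem_schubertVariety {α : SchubertCondition k n}
    {F : ℕ → Submodule ℂ (Fin n → ℂ)} {H : Gr k n} (hH : H ∉ schubertVariety α F)
    {M : Matrix (Fin k) (Fin n) ℂ} (hM : rowSpace M = H.1) :
    ∃ D : Matrix (Fin n) (Fin k) ℂ, (M * D).det ≠ 0 ∧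
      ∀ H' ∈ schubertVariety α F, ∀ M' : Matrix (Fin k) (Fin n) ℂ, rowSpace M' = H'.1 →
        (M' * D).det = 0 := by
  simp only [schubertVariety, Set.mem_ofPred_eq, not_forall, not_le, Nat.lt_succ_iff] at hH
  obtain ⟨i, hi⟩ := hH
  obtain ⟨D, hD, hDF⟩ :=
    exists_det_ne_zero_of_finrank_inf_le hM (linearIndependent_of_rowSpace hM) hi
  exact ⟨D, hD, fun H' hH' M' hM' =>
    det_mul_eq_zero_of_finrank_map_lt hM' (hDF.trans_lt (Nat.lt_of_succ_le (hH' i)))⟩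

theorem isClosed_schubertVariety (α : SchubertCondition k n)
    (F : ℕ → Submodule ℂ (Fin n → ℂ)) : IsClosed (schubertVariety α F) := by
  rw [← isOpen_compl_iff, isOpen_iff_forall_mem_open]
  intro H hH
  obtain ⟨M, hM⟩ := exists_rowSpace_eq H
  obtain ⟨D, hD, hDF⟩ := exists_det_of_notMem_schubertVariety hH hM
  refine ⟨Gr.nonvanishing (pluckerForm D), ?_,
    Gr.isOpen_nonvanishing (isHomogeneous_pluckerForm D), M, hM, by rwa [eval_pluckerForm]⟩
  rintro H' ⟨M', hM', h⟩ hH'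
  rw [eval_pluckerForm] at h
  exact h (hDF H' hH' M' hM')

/-- Greedy choice: the span of the `i` vectors already chosen is too small to contain `K i`. -/
theorem exists_linearIndependent_mem {V : Type*} [AddCommGroup V] [Module ℂ V]
    {k : ℕ} (K : Fin k → Submodule ℂ V) (hK : ∀ i : Fin k, (i : ℕ) + 1 ≤ Module.finrank ℂ (K i)) :
    ∃ v : Fin k → V, LinearIndependent ℂ v ∧ ∀ i, v i ∈ K i := by
  induction k with
  | zero => exact ⟨Fin.elim0, linearIndependent_empty_type, fun i => i.elim0⟩
  | succ k ih =>
    obtain ⟨v, hv, hvK⟩ := ih (fun i => K i.castSucc) fun i => hK i.castSucc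
    obtain ⟨w, hwK, hw⟩ : ∃ w ∈ K (Fin.last k), w ∉ Submodule.span ℂ (Set.range v) := by
      by_contra! hc
      have h1 : Module.finrank ℂ (K (Fin.last k)) ≤
          Module.finrank ℂ (Submodule.span ℂ (Set.range v)) := by
        have : Module.Finite ℂ (Submodule.span ℂ (Set.range v)) :=
          Module.Finite.span_of_finite ℂ (Set.finite_range v)
        exact Submodule.finrank_mono hc
      rw [finrank_span_eq_card hv, Fintype.card_fin] at h1
      have := hK (Fin.last k)
      simp only [Fin.val_last] at this
      omega
    refine ⟨Fin.snoc v w, linearIndependent_finSnoc.2 ⟨hv, hw⟩, fun i => ?_⟩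
    refine Fin.lastCases ?_ (fun j => ?_) i
    · simpa using hwK
    · simpa using hvK j

/-- This replaces the dimension conditions by a basis adapted to the flag. Conversely, the first `i
+ 1` rows of such a basis all lie in `F (α i + 1)`, since `F` and `α` are increasing. -/
theorem mem_schubertVariety_iff {α : SchubertCondition k n}
    {F : ℕ → Submodule ℂ (Fin n → ℂ)} (hF : Monotone F) {H : Gr k n} :
    H ∈ schubertVariety α F ↔ ∃ M : Matrix (Fin k) (Fin n) ℂ, rowSpace M = H.1 ∧
      ∀ i, M i ∈ F ((α i : ℕ) + 1) := by
  constructor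
  · intro h
    obtain ⟨M, hM, hMK⟩ := exists_linearIndependent_mem
      (fun i => H.1 ⊓ F ((α i : ℕ) + 1)) h
    refine ⟨M, ?_, fun i => (hMK i).2⟩
    refine Submodule.eq_of_le_of_finrank_eq ?_ ((finrank_rowSpace hM).trans H.2.symm)
    exact Submodule.span_le.2 (Set.range_subset_iff.2 fun i => (hMK i).1)
  · rintro ⟨M, hM, hMF⟩ i
    have hli := linearIndependent_of_rowSpace hM
    let v : Fin ((i : ℕ) + 1) → (Fin n → ℂ) := fun j => M (Fin.castLE (Nat.succ_le_of_lt i.2) j)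
    have hv : LinearIndependent ℂ v :=
      hli.comp _ (Fin.castLE_injective _)
    have h1 := finrank_span_eq_card hv
    rw [Fintype.card_fin] at h1
    rw [← h1]
    refine Submodule.finrank_mono (Submodule.span_le.2 (Set.range_subset_iff.2 fun j => ⟨?_, ?_⟩))
    · rw [← hM]
      exact Submodule.subset_span ⟨_, rfl⟩
    · refine hF ?_ (hMF _)
      have : α (Fin.castLE (Nat.succ_le_of_lt i.2) j) ≤ α i := by
        rw [α.le_iff_le, Fin.le_def]
        exact Nat.lt_succ_iff.1 j.2
      exact Nat.succ_le_succ this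

end OscSchubert

end

/-! ### Heights and chains of prime ideals. -/

noncomputable section
namespace OscSchubert
open MvPolynomial

/-- Polynomial rings over a field are Jacobson, so a maximal ideal contracts to a maximal ideal in
one variable less, and the extra variable adds one to the height. -/
theorem height_of_isMaximal_mvPolynomial_fin {K : Type*} [Field K] (s : ℕ)
    (P : Ideal (MvPolynomial (Fin s) K)) [P.IsMaximal] : P.height = s := by
  induction s with
  | zero =>
    let e := (isEmptyAlgEquiv K (Fin 0)).toRingEquiv
    have h1 : (P.map e).IsMaximal := Ideal.map_isMaximal_of_equiv e
    have h2 : P.map e = ⊥ := (Ideal.eq_bot_or_top _).resolve_right h1.ne_top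
    rw [← e.height_map P, h2, Ideal.height_bot, Nat.cast_zero]
  | succ s ih =>
    let e := (finSuccEquiv K s).toRingEquiv
    have h1 : (P.map e).IsMaximal := Ideal.map_isMaximal_of_equiv e
    have h2 : ((P.map e).under (MvPolynomial (Fin s) K)).IsMaximal :=
      Polynomial.isMaximal_comap_C_of_isJacobsonRing _
    have h3 : (P.map e).LiesOver ((P.map e).under (MvPolynomial (Fin s) K)) := ⟨rfl⟩
    rw [← e.height_map P, Polynomial.height_eq_height_add_one
      ((P.map e).under (MvPolynomial (Fin s) K)) (P.map e), ih, Nat.cast_succ]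

/-- In a finitely generated domain over a field, every maximal ideal has height at least the
transcendence degree. -/
theorem trdeg_le_height_of_isMaximal {K A : Type} [Field K] [CommRing A] [IsDomain A] [Algebra K A]
    [Algebra.FiniteType K A] {d : ℕ} (hd : (d : Cardinal) ≤ Algebra.trdeg K A)
    (m : Ideal A) [m.IsMaximal] : (d : ℕ∞) ≤ m.height := by
  -- Noether normalization: `A` is integral over a polynomial ring in `s` variables, and going down
  -- carries the height `s` of the contracted maximal ideal up to `m`.
  obtain ⟨s, g, hinj, hint⟩ := exists_integral_inj_algHom_of_fg K A
  let _ : Algebra (MvPolynomial (Fin s) K) A := g.toRingHom.toAlgebra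
  have : IsScalarTower K (MvPolynomial (Fin s) K) A :=
    IsScalarTower.of_algebraMap_eq fun x => (g.commutes x).symm
  have : FaithfulSMul (MvPolynomial (Fin s) K) A :=
    (faithfulSMul_iff_algebraMap_injective _ _).2 hinj
  have : Algebra.IsIntegral (MvPolynomial (Fin s) K) A := ⟨hint⟩
  have : IsNoetherianRing A := Algebra.FiniteType.isNoetherianRing K A
  have h1 : (m.under (MvPolynomial (Fin s) K)).IsMaximal :=
    Ideal.isMaximal_comap_of_isIntegral_of_isMaximal m
  have h2 : (s : ℕ∞) ≤ m.height := by
    rw [Ideal.height_eq_height_add_of_liesOver_of_hasGoingDown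
      (m.under (MvPolynomial (Fin s) K)) m, height_of_isMaximal_mvPolynomial_fin]
    exact le_self_add
  have h3 : Algebra.trdeg K A = s := by
    rw [← trdeg_add_eq K (MvPolynomial (Fin s) K), MvPolynomial.trdeg_of_isDomain,
      trdeg_eq_zero]
    simp
  rw [h3, Nat.cast_le] at hd
  exact (Nat.cast_le.2 hd).trans h2

/-- Dividing by the ideal of `S` lowers the height of `m` by at most the cardinality of `S`. A
longest chain in the quotient is pulled back. -/
theorem exists_ltSeries_of_le_height {A : Type*} [CommRing A] [IsNoetherianRing A] (m : Ideal A)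
    [m.IsPrime] {S : Set A} (hS : S ⊆ m) {d e : ℕ} (hd : (d : ℕ∞) ≤ m.height)
    (he : S.encard ≤ e) :
    ∃ l : LTSeries (PrimeSpectrum A), d ≤ l.length + e ∧ ∀ i, S ⊆ (l i).asIdeal := by
  have hSm : Ideal.span S ≤ m := Ideal.span_le.2 hS
  have hprime : (m.map (Ideal.Quotient.mk (Ideal.span S))).IsPrime :=
    Ideal.isPrime_map_quotientMk_of_isPrime hSm
  obtain ⟨l, -, hl⟩ :=
    (m.map (Ideal.Quotient.mk (Ideal.span S))).exists_ltSeries_length_eq_height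
  refine ⟨l.map (PrimeSpectrum.comap (Ideal.Quotient.mk (Ideal.span S)))
    (RingHom.strictMono_comap_of_surjective Ideal.Quotient.mk_surjective), ?_, fun i x hx => ?_⟩
  · have h := Ideal.height_le_height_add_encard_of_subset S hS
    rw [← hl] at h
    exact_mod_cast (hd.trans h).trans (add_le_add_right he _)
  · change Ideal.Quotient.mk (Ideal.span S) x ∈ (l i).asIdeal
    rw [Ideal.Quotient.eq_zero_iff_mem.2 (Ideal.subset_span hx)]
    exact Ideal.zero_mem _

/-- Krull's height theorem modulo the head of the chain: a minimal prime over `T` below the last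
member has height at most the cardinality of `T`, so it is not the last member itself. -/
theorem exists_isPrime_lt_of_ltSeries {R : Type*} [CommRing R] [IsNoetherianRing R]
    (l : LTSeries (PrimeSpectrum R)) {T : Set R} (hT : T ⊆ l.last.asIdeal)
    (hcard : T.encard < l.length) :
    ∃ q : Ideal R, q.IsPrime ∧ q < l.last.asIdeal ∧ l.head.asIdeal ≤ q ∧ T ⊆ q := by
  set P := l.head.asIdeal with hP
  set m := l.last.asIdeal with hm
  have hPm : P ≤ m := l.head_le_last
  let π := Ideal.Quotient.mk P
  have hm' : (m.map π).IsPrime := Ideal.isPrime_map_quotientMk_of_isPrime hPm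
  have hle : (l.length : ℕ∞) ≤ (m.map π).height := by
    let f : Fin (l.length + 1) → PrimeSpectrum (R ⧸ P) := fun i =>
      ⟨(l i).asIdeal.map π, Ideal.isPrime_map_quotientMk_of_isPrime (l.monotone (Fin.zero_le i))⟩
    have hf : ∀ i, (f i).asIdeal.comap π = (l i).asIdeal := fun i =>
      Ideal.comap_map_mk (l.monotone (Fin.zero_le i))
    have hmono : StrictMono f := fun i j hij => by
      refine lt_of_le_of_ne (Ideal.map_mono (l.strictMono hij).le) fun h => ?_
      exact (l.strictMono hij).ne (PrimeSpectrum.ext (by rw [← hf i, ← hf j, h]))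
    have := (⟨m.map π, hm'⟩ : PrimeSpectrum (R ⧸ P)).height_eq_orderHeight
    refine le_trans ?_ this.ge
    exact Order.length_le_height (p := LTSeries.mk l.length f hmono) le_rfl
  have hTm : π '' T ⊆ m.map π := by
    rintro _ ⟨x, hx, rfl⟩
    exact Ideal.mem_map_of_mem _ (hT hx)
  have hfin : (π '' T).Finite := (Set.finite_of_encard_le_coe hcard.le).image _
  obtain ⟨q, hq, hqm⟩ := Ideal.exists_minimalPrimes_le (Ideal.span_le.2 hTm)
  have hqp : q.IsPrime := hq.1.1
  refine ⟨q.comap π, inferInstance, lt_of_le_of_ne ?_ fun h => ?_, ?_, ?_⟩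
  · rw [← Ideal.comap_map_mk hPm]
    exact Ideal.comap_mono hqm
  · have hqm' : q = m.map π := by
      rw [← h, Ideal.map_comap_of_surjective _ Ideal.Quotient.mk_surjective]
    have h1 := Ideal.height_le_card_of_mem_minimalPrimes_span hfin hq
    rw [hqm', Set.Finite.cast_ncard_eq hfin] at h1
    refine absurd (hle.trans h1) (not_le.2 (lt_of_le_of_lt ?_ hcard))
    exact Set.encard_image_le _ _
  · intro x hx
    rw [Ideal.mem_comap, Ideal.Quotient.eq_zero_iff_mem.2 hx]
    exact q.zero_mem
  · intro x hx
    exact hq.1.2 (Ideal.subset_span ⟨x, hx, rfl⟩)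

end OscSchubert

end

/-! ### Cones over subsets of the Grassmannian and their hyperplane sections. -/

noncomputable section
namespace OscSchubert
open MvPolynomial

variable {k n : ℕ}

attribute [local instance] MvPolynomial.gradedAlgebra

/-- The ideal of the polynomials in the Plücker coordinates that vanish on the cone over a set
of `k`-planes. -/
def coneIdeal (Z : Set (Gr k n)) : Ideal (MvPolynomial (Fin k ↪o Fin n) ℂ) :=
  vanishingIdeal ℂ {v | ∃ H ∈ Z, ∃ M : Matrix (Fin k) (Fin n) ℂ,
    rowSpace M = H.1 ∧ maxMinors M = v}

theorem mem_coneIdeal {Z : Set (Gr k n)} {p : MvPolynomial (Fin k ↪o Fin n) ℂ} :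
    p ∈ coneIdeal Z ↔ ∀ H ∈ Z, ∀ M : Matrix (Fin k) (Fin n) ℂ, rowSpace M = H.1 →
      eval (maxMinors M) p = 0 := by
  constructor
  · intro h H hH M hM
    exact h _ ⟨H, hH, M, hM, rfl⟩
  · rintro h _ ⟨H, hH, M, hM, rfl⟩
    exact h H hH M hM

theorem coneIdeal_anti {Z Z' : Set (Gr k n)} (h : Z ⊆ Z') : coneIdeal Z' ≤ coneIdeal Z :=
  fun _ hp => mem_coneIdeal.2 fun H hH => mem_coneIdeal.1 hp H (h hH)

theorem mem_coneIdeal_iff_of_isHomogeneous {Z : Set (Gr k n)}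
    {p : MvPolynomial (Fin k ↪o Fin n) ℂ} {d : ℕ} (hp : p.IsHomogeneous d) :
    p ∈ coneIdeal Z ↔ Disjoint Z (Gr.nonvanishing p) := by
  rw [mem_coneIdeal, Set.disjoint_left]
  refine forall₂_congr fun H _ => ?_
  refine ⟨fun h => ?_, fun h M hM => ?_⟩
  · rintro ⟨M, hM, h0⟩
    exact h0 (h M hM)
  · rw [Gr.mem_nonvanishing_iff hp hM, not_not] at h
    exact h

theorem rowSpace_mul_of_det_ne_zero {g : Matrix (Fin k) (Fin k) ℂ} (hg : g.det ≠ 0)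
    (M : Matrix (Fin k) (Fin n) ℂ) : rowSpace (g * M) = rowSpace M := by
  refine le_antisymm (rowSpace_mul_le g M) ?_
  have := rowSpace_mul_le g⁻¹ (g * M)
  rwa [← Matrix.mul_assoc, Matrix.nonsing_inv_mul _ hg.isUnit, Matrix.one_mul] at this

theorem exists_maxMinors_eq_smul (hk : 0 < k) (M : Matrix (Fin k) (Fin n) ℂ) {c : ℂ}
    (hc : c ≠ 0) : ∃ M', rowSpace M' = rowSpace M ∧ maxMinors M' = c • maxMinors M := by
  let g : Matrix (Fin k) (Fin k) ℂ := Matrix.diagonal (Function.update 1 ⟨0, hk⟩ c)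
  have hg : g.det = c := by
    rw [Matrix.det_diagonal, Finset.prod_update_of_mem (Finset.mem_univ _)]
    simp
  exact ⟨g * M, rowSpace_mul_of_det_ne_zero (hg ▸ hc) M, by rw [maxMinors_mul, hg]⟩

/-- The polynomial `c ↦ p(c v)` has the values of the homogeneous components at `v` as coefficients,
and it vanishes at infinitely many `c`. -/
theorem eval_homogeneousComponent_eq_zero {σ : Type*} {p : MvPolynomial σ ℂ} {v : σ → ℂ}
    (h : ∀ c : ℂ, c ≠ 0 → eval (c • v) p = 0) (i : ℕ) :
    eval v (homogeneousComponent i p) = 0 := by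
  let Q : Polynomial ℂ := ∑ i ∈ Finset.range (p.totalDegree + 1),
    Polynomial.C (eval v (homogeneousComponent i p)) * Polynomial.X ^ i
  have hQ : ∀ c : ℂ, Q.eval c = eval (c • v) p := fun c => by
    conv_rhs => rw [← sum_homogeneousComponent p, map_sum]
    rw [Polynomial.eval_finsetSum]
    refine Finset.sum_congr rfl fun i _ => ?_
    rw [eval_smul_of_isHomogeneous (homogeneousComponent_isHomogeneous i p)]
    rw [Polynomial.eval_mul, Polynomial.eval_C, Polynomial.eval_pow, Polynomial.eval_X, mul_comm]
  have hQ0 : Q = 0 := by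
    refine Polynomial.eq_zero_of_infinite_isRoot _
      ((Set.finite_singleton (0 : ℂ)).infinite_compl.mono fun c hc => ?_)
    exact (hQ c).trans (h c hc)
  by_cases hi : i < p.totalDegree + 1
  · have := congrArg (fun q => Polynomial.coeff q i) hQ0
    simp only [Q, Polynomial.finsetSum_coeff, Polynomial.coeff_C_mul, Polynomial.coeff_X_pow,
      mul_ite, mul_one, mul_zero, Finset.sum_ite_eq, Finset.mem_range, hi, if_true,
      Polynomial.coeff_zero] at this
    exact this
  · rw [homogeneousComponent_eq_zero _ _ (by omega), map_zero]

theorem isHomogeneous_coneIdeal (hk : 0 < k) (Z : Set (Gr k n)) :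
    (coneIdeal Z).IsHomogeneous (homogeneousSubmodule (Fin k ↪o Fin n) ℂ) := by
  intro i p hp
  have : (DirectSum.decompose (homogeneousSubmodule (Fin k ↪o Fin n) ℂ) p i :
      MvPolynomial (Fin k ↪o Fin n) ℂ) = homogeneousComponent i p :=
    decomposition.decompose'_apply p i
  rw [this, mem_coneIdeal]
  intro H hH M hM
  refine eval_homogeneousComponent_eq_zero (fun c hc => ?_) i
  obtain ⟨M', hM', hv⟩ := exists_maxMinors_eq_smul hk M hc
  rw [← hv]
  exact mem_coneIdeal.1 hp H hH M' (hM'.trans hM)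

/-- For a homogeneous ideal, primality need only be tested on homogeneous elements. For these, not
lying in the ideal means that a basic open set meets `Z`, and two such sets meet inside an
irreducible `Z`. -/
theorem isPrime_coneIdeal (hk : 0 < k) {Z : Set (Gr k n)} (hZ : IsIrreducible Z) :
    (coneIdeal Z).IsPrime := by
  refine Ideal.IsHomogeneous.isPrime_of_homogeneous_mem_or_mem (isHomogeneous_coneIdeal hk Z)
    ?_ ?_
  · rw [Ideal.ne_top_iff_one, mem_coneIdeal_iff_of_isHomogeneous (isHomogeneous_one _ _),
      Set.not_disjoint_iff]
    obtain ⟨H, hH⟩ := hZ.nonempty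
    obtain ⟨M, hM⟩ := exists_rowSpace_eq H
    exact ⟨H, hH, M, hM, by simp⟩
  · rintro p q ⟨d, hp⟩ ⟨e, hq⟩ hpq
    rw [mem_homogeneousSubmodule] at hp hq
    rw [mem_coneIdeal_iff_of_isHomogeneous hp, mem_coneIdeal_iff_of_isHomogeneous hq]
    by_contra! hc
    rw [Set.not_disjoint_iff_nonempty_inter, Set.not_disjoint_iff_nonempty_inter] at hc
    obtain ⟨H, hH, hHp, hHq⟩ := hZ.isPreirreducible _ _ (Gr.isOpen_nonvanishing hp)
      (Gr.isOpen_nonvanishing hq) hc.1 hc.2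
    obtain ⟨M, hM⟩ := exists_rowSpace_eq H
    have := mem_coneIdeal.1 hpq H hH M hM
    rw [map_mul] at this
    rcases mul_eq_zero.1 this with h | h
    · exact (Gr.mem_nonvanishing_iff hp hM).1 hHp h
    · exact (Gr.mem_nonvanishing_iff hq hM).1 hHq h

theorem mem_of_forall_notMem_nonvanishing {Z : Set (Gr k n)} (hZ : IsClosed Z) {H : Gr k n}
    (h : ∀ (d : ℕ) (p : MvPolynomial (Fin k ↪o Fin n) ℂ), p.IsHomogeneous d →
      p ∈ coneIdeal Z → H ∉ Gr.nonvanishing p) : H ∈ Z := by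
  by_contra hH
  obtain ⟨d, p, hp, hHp, hpZ⟩ := Gr.exists_nonvanishing_subset hZ.isOpen_compl hH
  exact h d p hp ((mem_coneIdeal_iff_of_isHomogeneous hp).2
    (Set.disjoint_left.2 fun x hx hxp => hpZ hxp hx)) hHp

theorem coneIdeal_lt {Z Z' : Set (Gr k n)} (hZ : IsClosed Z) (h : Z ⊂ Z') :
    coneIdeal Z' < coneIdeal Z := by
  refine lt_of_le_not_ge (coneIdeal_anti h.subset) fun hle => h.not_subset fun H hH => ?_
  exact mem_of_forall_notMem_nonvanishing hZ fun d p hp hpZ =>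
    Set.disjoint_left.1 ((mem_coneIdeal_iff_of_isHomogeneous hp).1 (hle hpZ)) hH

/-- The Plücker relations, in the form `det(M D)^(k-1) det(M D') = det(det(M D_{i,j}))`, where
`D_{i,j}` is `D` with its column `i` replaced by the column `j` of `D'`. -/
theorem det_of_det_mul_updateCol (M : Matrix (Fin k) (Fin n) ℂ) (D D' : Matrix (Fin n) (Fin k) ℂ) :
    (Matrix.of fun i j => ∑ s, D' s j * (M * D.updateCol i (Pi.single s 1)).det).det
      = (M * D).det ^ (k - 1) * (M * D').det := by
  have : (Matrix.of fun i j => ∑ s, D' s j * (M * D.updateCol i (Pi.single s 1)).det)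
      = (M * D).adjugate * (M * D') := by
    ext i j
    simp only [Matrix.of_apply, Matrix.mul_updateCol, ← Matrix.cramer_apply,
      Matrix.cramer_eq_adjugate_mulVec]
    rw [← Matrix.mul_assoc, Matrix.mul_apply]
    refine Finset.sum_congr rfl fun s _ => ?_
    rw [Matrix.mulVec_mulVec, Matrix.mulVec_single_one, mul_comm]
    rfl
  rw [this, Matrix.det_mul, Matrix.det_adjugate, Fintype.card_fin]

/-- A nonzero vector that satisfies the Plücker relations consists of the maximal minors of a
matrix, up to a factor. -/
theorem exists_eq_smul_maxMinors (hk : 0 < k) {x : (Fin k ↪o Fin n) → ℂ} (hx : x ≠ 0)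
    (h : ∀ p ∈ coneIdeal (Set.univ : Set (Gr k n)), eval x p = 0) :
    ∃ (M : Matrix (Fin k) (Fin n) ℂ) (c : ℂ), LinearIndependent ℂ M.row ∧ x = c • maxMinors M := by
  obtain ⟨β, hβ⟩ := Function.ne_iff.1 hx
  rw [Pi.zero_apply] at hβ
  set D : Matrix (Fin n) (Fin k) ℂ := (1 : Matrix (Fin n) (Fin n) ℂ).submatrix id β
  -- If `x` comes from a matrix normalized to be the identity in the columns `β`, Cramer's rule
  -- forces these entries.
  let M : Matrix (Fin k) (Fin n) ℂ := Matrix.of fun i s =>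
    eval x (pluckerForm (D.updateCol i (Pi.single s 1))) / x β
  have key : ∀ D' : Matrix (Fin n) (Fin k) ℂ,
      eval x (pluckerForm D') = x β * (M * D').det := fun D' => by
    have h1 := h (Matrix.det (Matrix.of fun i j => ∑ s, C (D' s j) *
      pluckerForm (D.updateCol i (Pi.single s 1))) - pluckerForm D ^ (k - 1) * pluckerForm D')
      (mem_coneIdeal.2 fun _ _ M _ => by
        rw [map_sub, map_mul, map_pow, RingHom.map_det, eval_pluckerForm, eval_pluckerForm,
          ← det_of_det_mul_updateCol, sub_eq_zero]
        congr 1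
        ext i j
        simp [eval_pluckerForm])
    rw [map_sub, map_mul, map_pow, RingHom.map_det, sub_eq_zero] at h1
    have h2 : (eval x).mapMatrix (Matrix.of fun i j => ∑ s, C (D' s j) *
        pluckerForm (D.updateCol i (Pi.single s 1))) = x β • (M * D') := by
      ext i j
      simp only [RingHom.mapMatrix_apply, Matrix.map_apply, Matrix.of_apply, map_sum, map_mul,
        eval_C, Matrix.smul_apply, Matrix.mul_apply, M, smul_eq_mul, Finset.mul_sum]
      refine Finset.sum_congr rfl fun s _ => ?_
      field_simp
    rw [h2, Matrix.det_smul, Fintype.card_fin, pluckerForm_one_submatrix, eval_X] at h1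
    obtain ⟨k, rfl⟩ := Nat.exists_eq_succ_of_ne_zero hk.ne'
    rw [pow_succ, mul_assoc, Nat.succ_sub_one] at h1
    exact (mul_left_cancel₀ (pow_ne_zero _ hβ) h1).symm
  refine ⟨M, x β, ?_, ?_⟩
  · refine linearIndependent_of_det_mul_ne_zero (D := D) fun h0 => hβ ?_
    have := key D
    rwa [h0, mul_zero, pluckerForm_one_submatrix, eval_X] at this
  · funext γ
    have := key ((1 : Matrix (Fin n) (Fin n) ℂ).submatrix id γ)
    rw [pluckerForm_one_submatrix, eval_X] at this
    rw [this, Pi.smul_apply, smul_eq_mul, maxMinors]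
    congr 2
    ext i j
    simp [Matrix.mul_apply, Matrix.one_apply]

theorem maxMinors_ne_zero {M : Matrix (Fin k) (Fin n) ℂ} (h : LinearIndependent ℂ M.row) :
    maxMinors M ≠ 0 := fun h0 => by
  obtain ⟨D, hD⟩ := exists_rightInverse h
  have := det_mul_eq_sum M D
  rw [hD, Matrix.det_one, h0] at this
  simp at this

open TopologicalSpace in
/-- A chain of `d` proper inclusions of irreducible closed subsets of the Grassmannian has a last
member that meets the intersection of any `d` hyperplanes in Plücker space. -/
theorem exists_mem_last_forall_notMem_nonvanishing (hk : 0 < k)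
    (l : LTSeries (IrreducibleCloseds (Gr k n)))
    (T : Fin l.length → MvPolynomial (Fin k ↪o Fin n) ℂ) (hT : ∀ i, (T i).IsHomogeneous 1) :
    ∃ H ∈ l.last, ∀ i, H ∉ Gr.nonvanishing (T i) := by
  -- Larger closed sets have smaller ideals, so the chain is reversed and its head is the ideal of
  -- `l.last`.
  let f : Fin (l.length + 1) → PrimeSpectrum (MvPolynomial (Fin k ↪o Fin n) ℂ) := fun i =>
    ⟨coneIdeal (l i.rev : Set (Gr k n)), isPrime_coneIdeal hk (l i.rev).isIrreducible⟩
  have hf : StrictMono f := fun i j hij =>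
    coneIdeal_lt (l j.rev).isClosed
      (SetLike.coe_ssubset_coe.2 (l.strictMono (Fin.rev_lt_rev.2 hij)))
  let L : LTSeries (PrimeSpectrum (MvPolynomial (Fin k ↪o Fin n) ℂ)) :=
    LTSeries.mk l.length f hf
  -- The ideal of the vertex of the cone prolongs the chain by one step. The length then exceeds the
  -- number of linear forms, which leaves room for a prime strictly below `m₀`.
  let m₀ : PrimeSpectrum (MvPolynomial (Fin k ↪o Fin n) ℂ) :=
    ⟨vanishingIdeal ℂ {(0 : (Fin k ↪o Fin n) → ℂ)}, inferInstance⟩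
  have hm₀ : ∀ {p : MvPolynomial (Fin k ↪o Fin n) ℂ}, p ∈ m₀.asIdeal ↔ eval 0 p = 0 :=
    fun {p} => mem_vanishingIdeal_singleton_iff 0 p
  have hlt : L.last < m₀ := by
    have hlast : L.last.asIdeal = coneIdeal (l (Fin.rev (Fin.last _)) : Set (Gr k n)) := rfl
    obtain ⟨H, hH⟩ := (l (Fin.rev (Fin.last _))).isIrreducible.nonempty
    obtain ⟨M, hM⟩ := exists_rowSpace_eq H
    refine lt_of_le_not_ge (fun p hp => ?_) fun hle => ?_
    · rw [hlast] at hp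
      refine hm₀.2 ?_
      have h1 := (isHomogeneous_coneIdeal hk _).mem_iff.1 hp 0
      have h2 : (DirectSum.decompose (homogeneousSubmodule (Fin k ↪o Fin n) ℂ) p 0 :
          MvPolynomial (Fin k ↪o Fin n) ℂ) = homogeneousComponent 0 p :=
        decomposition.decompose'_apply p 0
      rw [h2, homogeneousComponent_zero] at h1
      have h3 := mem_coneIdeal.1 h1 H hH M hM
      rw [eval_C] at h3
      rw [eval_zero, constantCoeff_eq, h3]
    · obtain ⟨β, hβ⟩ := Function.ne_iff.1 (maxMinors_ne_zero (linearIndependent_of_rowSpace hM))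
      have h1 : X β ∈ L.last.asIdeal := hle (hm₀.2 (by simp))
      rw [hlast] at h1
      exact hβ (by simpa using mem_coneIdeal.1 h1 H hH M hM)
  obtain ⟨q, hq, hqlt, hqle, hTq⟩ := exists_isPrime_lt_of_ltSeries (L.snoc m₀ hlt)
    (T := Set.range T) (by
      rw [RelSeries.last_snoc]
      rintro _ ⟨i, rfl⟩
      refine hm₀.2 ?_
      have := eval_smul_of_isHomogeneous (hT i) 0 0
      simpa using this) (by
      refine lt_of_le_of_lt ?_ (Nat.cast_lt.2 (Nat.lt_succ_self l.length))
      rw [← Set.image_univ]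
      refine (Set.encard_image_le _ _).trans ?_
      simp)
  rw [RelSeries.last_snoc] at hqlt
  rw [RelSeries.head_snoc] at hqle
  have hhead : L.head.asIdeal = coneIdeal (l.last : Set (Gr k n)) := by
    change coneIdeal (l (Fin.rev 0) : Set (Gr k n)) = _
    rw [Fin.rev_zero]
    rfl
  rw [hhead] at hqle
  -- If `q` had no zero other than the origin, the Nullstellensatz would give `m₀ ≤ q`.
  obtain ⟨x, hx, hx0⟩ : ∃ x ∈ zeroLocus ℂ q, x ≠ 0 := by
    by_contra! hc
    refine not_le_of_gt hqlt ?_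
    rw [← IsPrime.vanishingIdeal_zeroLocus (K := ℂ) q]
    exact vanishingIdeal_anti_mono hc
  obtain ⟨M, c, hM, rfl⟩ := exists_eq_smul_maxMinors hk hx0 fun p hp =>
    hx p (hqle (coneIdeal_anti (Set.subset_univ _) hp))
  have hc : c ≠ 0 := by
    rintro rfl
    exact hx0 (zero_smul _ _)
  have hvan : ∀ (d : ℕ) (p : MvPolynomial (Fin k ↪o Fin n) ℂ), p.IsHomogeneous d → p ∈ q →
      eval (maxMinors M) p = 0 := fun d p hp hpq => by
    have : eval (c • maxMinors M) p = 0 := hx p hpq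
    rw [eval_smul_of_isHomogeneous hp] at this
    exact (mul_eq_zero.1 this).resolve_left (pow_ne_zero _ hc)
  let H : Gr k n := ⟨rowSpace M, finrank_rowSpace hM⟩
  have hHM : rowSpace M = H.1 := rfl
  refine ⟨H, mem_of_forall_notMem_nonvanishing l.last.isClosed fun d p hp hpZ => ?_, fun i => ?_⟩
  · rw [Gr.mem_nonvanishing_iff hp hHM, not_not]
    exact hvan d p hp (hqle hpZ)
  · rw [Gr.mem_nonvanishing_iff (hT i) hHM, not_not]
    exact hvan 1 _ (hT i) (hTq ⟨i, rfl⟩)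

end OscSchubert

end

/-! ### Wronskians of polynomials. -/

noncomputable section
namespace OscSchubert
open Polynomial

variable {k : ℕ}

/-- The Wronskian determinant of a family of polynomials. -/
def wronskianDet (f : Fin k → ℂ[X]) : ℂ[X] :=
  (Matrix.of fun i j : Fin k => derivative^[j] (f i)).det

theorem wronskianDet_sum_smul (g : Matrix (Fin k) (Fin k) ℂ) (f : Fin k → ℂ[X]) :
    wronskianDet (fun i => ∑ j, g i j • f j) = C g.det * wronskianDet f := by
  rw [wronskianDet, wronskianDet, RingHom.map_det, ← Matrix.det_mul]
  congr 1
  ext1 i j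
  simp [Matrix.mul_apply, iterate_derivative_sum, smul_eq_C_mul, iterate_derivative_C_mul]

theorem linearIndependent_of_wronskianDet_ne_zero {f : Fin k → ℂ[X]} (h : wronskianDet f ≠ 0) :
    LinearIndependent ℂ f := by
  rw [Fintype.linearIndependent_iff]
  intro c hc
  by_contra! hne
  obtain ⟨i, hi⟩ := hne
  refine h (Matrix.exists_vecMul_eq_zero_iff.1 ⟨fun i => C (c i), ?_, ?_⟩)
  · exact fun h0 => hi (C_eq_zero.1 (congrFun h0 i))
  · funext j
    have := congrArg (fun q => derivative^[(j : ℕ)] q) hc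
    simp only [iterate_derivative_sum, smul_eq_C_mul, iterate_derivative_C_mul,
      iterate_derivative_zero] at this
    exact this

/-- The factor `u ^ j` in column `j` makes up for the loss caused by `j` derivatives. With `u = X -
C a` this controls the order of vanishing at `a`, and with `u = X` the degree. -/
theorem prod_pow_mul_wronskianDet (f : Fin k → ℂ[X]) (u : ℂ[X]) :
    u ^ (∑ j : Fin k, (j : ℕ)) * wronskianDet f
      = (Matrix.of fun i j : Fin k => u ^ (j : ℕ) * derivative^[j] (f i)).det := by
  rw [← Finset.prod_pow_eq_pow_sum, wronskianDet, ← Matrix.det_mul_row]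
  rfl

/-- After this rescaling all of row `i` is divisible by `(X - C a) ^ e i`. The powers spent on the
columns are then cancelled. -/
theorem pow_dvd_wronskianDet {f : Fin k → ℂ[X]} {a : ℂ} {e : Fin k → ℕ}
    (h : ∀ i, (X - C a) ^ e i ∣ f i) {c : ℕ} (hc : c + ∑ j : Fin k, (j : ℕ) = ∑ i, e i) :
    (X - C a) ^ c ∣ wronskianDet f := by
  have h1 : ∀ i j : Fin k, (X - C a) ^ e i ∣ (X - C a) ^ (j : ℕ) * derivative^[j] (f i) :=
    fun i j => by
      obtain ⟨q, hq⟩ := pow_sub_dvd_iterate_derivative_of_pow_dvd (j : ℕ) (h i)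
      rw [hq, ← mul_assoc, ← pow_add]
      exact (pow_dvd_pow _ (by omega)).mul_right _
  choose B hB using h1
  have h2 := prod_pow_mul_wronskianDet f (X - C a)
  simp only [hB] at h2
  rw [Matrix.det_mul_column (fun i => (X - C a) ^ e i) B, Finset.prod_pow_eq_pow_sum, ← hc,
    add_comm, pow_add, mul_assoc] at h2
  exact ⟨_, mul_left_cancel₀ (pow_ne_zero _ (X_sub_C_ne_zero a)) h2⟩

theorem natDegree_X_pow_mul_iterate_derivative_le {f : ℂ[X]} {d : ℕ} (h : f.natDegree ≤ d)
    (j : ℕ) : (X ^ j * derivative^[j] f).natDegree ≤ d := by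
  rcases lt_or_ge f.natDegree j with hj | hj
  · rw [iterate_derivative_eq_zero hj, mul_zero, natDegree_zero]
    exact Nat.zero_le _
  · refine natDegree_mul_le.trans ?_
    rw [natDegree_X_pow]
    have := natDegree_iterate_derivative f j
    omega

theorem coeff_X_pow_mul_iterate_derivative (f : ℂ[X]) (d j : ℕ) :
    (X ^ j * derivative^[j] f).coeff d = (d.descFactorial j : ℂ) * f.coeff d := by
  rw [coeff_X_pow_mul']
  split_ifs with h
  · rw [coeff_iterate_derivative, Nat.sub_add_cancel h, nsmul_eq_mul]
  · rw [Nat.descFactorial_of_lt (not_le.1 h), Nat.cast_zero, zero_mul]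

theorem natDegree_wronskianDet_add_le {f : Fin k → ℂ[X]} {d : Fin k → ℕ}
    (h : ∀ i, (f i).natDegree ≤ d i) (h0 : wronskianDet f ≠ 0) :
    (wronskianDet f).natDegree + ∑ j : Fin k, (j : ℕ) ≤ ∑ i, d i := by
  have h1 := congrArg natDegree (prod_pow_mul_wronskianDet f X)
  rw [natDegree_X_pow_mul _ h0] at h1
  rw [h1, Matrix.det_apply]
  refine natDegree_sum_le_of_forall_le _ _ fun σ _ => ?_
  refine (natDegree_smul_le _ _).trans ((natDegree_prod_le _ _).trans ?_)
  rw [← Equiv.sum_comp σ d]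
  exact Finset.sum_le_sum fun i _ => natDegree_X_pow_mul_iterate_derivative_le (h _) _

theorem coeff_prod_of_forall_natDegree_le {ι : Type*} (s : Finset ι) (f : ι → ℂ[X]) (d : ι → ℕ)
    (h : ∀ i ∈ s, (f i).natDegree ≤ d i) :
    (∏ i ∈ s, f i).coeff (∑ i ∈ s, d i) = ∏ i ∈ s, (f i).coeff (d i) := by
  classical
  induction s using Finset.induction_on with
  | empty => simp
  | insert a s ha ih =>
    rw [Finset.prod_insert ha, Finset.prod_insert ha, Finset.sum_insert ha,
      coeff_mul_add_eq_of_natDegree_le (h a (Finset.mem_insert_self a s)),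
      ih fun i hi => h i (Finset.mem_insert_of_mem hi)]
    refine (natDegree_prod_le _ _).trans (Finset.sum_le_sum fun i hi => ?_)
    exact h i (Finset.mem_insert_of_mem hi)

/-- The entry in column `j` is a monic polynomial of degree `j` in `d i`, so this is a Vandermonde
determinant. -/
theorem det_descFactorial_ne_zero {d : Fin k → ℕ} (hd : Function.Injective d) :
    (Matrix.of fun i j : Fin k => ((d i).descFactorial j : ℂ)).det ≠ 0 := by
  have h := Matrix.det_eval_matrixOfPolynomials_eq_det_vandermonde (fun i => (d i : ℂ))
    (fun j : Fin k => descPochhammer ℂ j) (fun j => descPochhammer_natDegree ℂ j)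
    (fun j => monic_descPochhammer ℂ j)
  simp only [descPochhammer_eval_eq_descFactorial] at h
  rw [← h, Matrix.det_vandermonde_ne_zero_iff]
  exact fun i j hij => hd (Nat.cast_injective hij)

/-- The top possible coefficient of `X ^ (∑ j) * W`, with `W` the Wronskian, is the product of the
leading coefficients and the determinant of descending factorials of the degrees. -/
theorem wronskianDet_ne_zero_of_injective_natDegree {f : Fin k → ℂ[X]} (h0 : ∀ i, f i ≠ 0)
    (h : Function.Injective fun i => (f i).natDegree) : wronskianDet f ≠ 0 := by
  intro hW
  have h1 := prod_pow_mul_wronskianDet f X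
  rw [hW, mul_zero] at h1
  have h2 := congrArg (fun q => q.coeff (∑ i, (f i).natDegree)) h1
  have h3 : ∀ σ : Equiv.Perm (Fin k),
      (∏ i : Fin k, X ^ (i : ℕ) * derivative^[(i : ℕ)] (f (σ i))).coeff (∑ i, (f i).natDegree)
        = ∏ i, ((f (σ i)).natDegree.descFactorial i : ℂ) * (f (σ i)).leadingCoeff := fun σ => by
    rw [← Equiv.sum_comp σ fun i => (f i).natDegree, coeff_prod_of_forall_natDegree_le]
    · exact Finset.prod_congr rfl fun i _ => coeff_X_pow_mul_iterate_derivative _ _ _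
    · exact fun i _ => natDegree_X_pow_mul_iterate_derivative_le le_rfl _
  simp only [coeff_zero, Matrix.det_apply, finsetSum_coeff, coeff_smul, Matrix.of_apply, h3] at h2
  have h4 := Matrix.det_mul_column (fun i => (f i).leadingCoeff)
    (Matrix.of fun i j : Fin k => ((f i).natDegree.descFactorial j : ℂ))
  rw [Matrix.det_apply] at h4
  simp only [Matrix.of_apply, mul_comm (leadingCoeff _)] at h4
  rw [← h2] at h4
  exact mul_ne_zero (Finset.prod_ne_zero_iff.2 fun i _ => leadingCoeff_ne_zero.2 (h0 i))
    (det_descFactorial_ne_zero h) h4.symm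

theorem linearIndependent_of_injective_natDegree {f : Fin k → ℂ[X]} (h0 : ∀ i, f i ≠ 0)
    (h : Function.Injective fun i => (f i).natDegree) : LinearIndependent ℂ f :=
  linearIndependent_of_wronskianDet_ne_zero (wronskianDet_ne_zero_of_injective_natDegree h0 h)

/-- Echelon form with respect to the degree: if some `u` in `U` has a nonzero coefficient at `N`,
the elements of lower degree form a hyperplane in `U`, to which the induction applies. -/
theorem exists_strictMono_natDegree (N : ℕ) {k : ℕ} {U : Submodule ℂ ℂ[X]}
    (hU : U ≤ degreeLT ℂ N) (hk : Module.finrank ℂ U = k) :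
    ∃ f : Fin k → ℂ[X], (∀ i, f i ∈ U) ∧ (∀ i, f i ≠ 0) ∧
      StrictMono fun i => (f i).natDegree := by
  induction N generalizing k U with
  | zero =>
    have hU0 : U = ⊥ := by
      refine (Submodule.eq_bot_iff _).2 fun p hp => ?_
      have := mem_degreeLT.1 (hU hp)
      rwa [Nat.cast_zero, Nat.WithBot.lt_zero_iff, degree_eq_bot] at this
    subst hU0
    rw [finrank_bot] at hk
    subst hk
    exact ⟨Fin.elim0, fun i => i.elim0, fun i => i.elim0, fun i => i.elim0⟩
  | succ N ih =>
    by_cases hN : U ≤ degreeLT ℂ N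
    · exact ih hN hk
    obtain ⟨u, huU, hu⟩ := Set.not_subset.1 hN
    have hmem : ∀ p ∈ U, p ∈ degreeLT ℂ N ↔ p.coeff N = 0 := fun p hp => by
      rw [mem_degreeLT]
      refine ⟨coeff_eq_zero_of_degree_lt, fun h => ?_⟩
      rw [degree_lt_iff_coeff_zero]
      intro m hm
      rcases hm.eq_or_lt with rfl | hm
      · exact h
      · exact (degree_lt_iff_coeff_zero _ _).1 (mem_degreeLT.1 (hU hp)) m hm
    have huN : u.coeff N ≠ 0 := fun h => hu ((hmem u huU).2 h)
    have hfin : FiniteDimensional ℂ U :=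
      have : FiniteDimensional ℂ (degreeLT ℂ (N + 1)) :=
        Module.Finite.equiv (degreeLTEquiv ℂ (N + 1)).symm
      Submodule.finiteDimensional_of_le hU
    let φ := (lcoeff ℂ N).domRestrict U
    have hφ : Function.Surjective φ := fun c =>
      ⟨(c / u.coeff N) • ⟨u, huU⟩, by simp [φ, huN]⟩
    have hker : (LinearMap.ker φ).map U.subtype = U ⊓ degreeLT ℂ N := by
      ext p
      simp only [Submodule.mem_map, LinearMap.mem_ker, Submodule.subtype_apply, Submodule.mem_inf]
      constructor
      · rintro ⟨q, hq, rfl⟩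
        exact ⟨q.2, (hmem q q.2).2 hq⟩
      · rintro ⟨hp, hpN⟩
        exact ⟨⟨p, hp⟩, (hmem p hp).1 hpN, rfl⟩
    have hdim := LinearMap.finrank_range_add_finrank_ker φ
    rw [LinearMap.range_eq_top.2 hφ, finrank_top, Module.finrank_self,
      ← Submodule.finrank_map_subtype_eq, hker, hk] at hdim
    obtain ⟨k, rfl⟩ : ∃ k', k = k' + 1 := ⟨k - 1, by omega⟩
    obtain ⟨f, hfU, hf0, hf⟩ := ih (U := U ⊓ degreeLT ℂ N) inf_le_right
      (by omega : Module.finrank ℂ (U ⊓ degreeLT ℂ N : Submodule ℂ ℂ[X]) = k)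
    have hu0 : u ≠ 0 := by
      rintro rfl
      exact huN (coeff_zero N)
    have hlt : ∀ i, (f i).natDegree < u.natDegree := fun i =>
      ((natDegree_lt_iff_degree_lt (hf0 i)).2 (mem_degreeLT.1 (hfU i).2)).trans_le
        (le_natDegree_of_ne_zero huN)
    refine ⟨Fin.snoc f u, fun i => ?_, fun i => ?_, fun i j hij => ?_⟩
    · refine Fin.lastCases ?_ (fun j => ?_) i
      · simpa using huU
      · simpa using (hfU j).1
    · refine Fin.lastCases ?_ (fun j => ?_) i
      · simpa using hu0
      · simpa using hf0 j
    · induction j using Fin.lastCases with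
      | last =>
        induction i using Fin.lastCases with
        | last => exact absurd hij (lt_irrefl _)
        | cast i => simpa using hlt i
      | cast j =>
        induction i using Fin.lastCases with
        | last => exact absurd hij (not_lt.2 (Fin.le_last _))
        | cast i => simpa using hf (Fin.castSucc_lt_castSucc_iff.1 hij)

/-- A basis of the span with distinct degrees has a nonzero Wronskian, which is a constant multiple
of that of `f`. -/
theorem wronskianDet_ne_zero {f : Fin k → ℂ[X]} (hf : LinearIndependent ℂ f) {N : ℕ}
    (hN : ∀ i, f i ∈ degreeLT ℂ N) : wronskianDet f ≠ 0 := by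
  have hU : Submodule.span ℂ (Set.range f) ≤ degreeLT ℂ N :=
    Submodule.span_le.2 (Set.range_subset_iff.2 hN)
  obtain ⟨q, hqU, hq0, hq⟩ := exists_strictMono_natDegree N hU
    ((finrank_span_eq_card hf).trans (Fintype.card_fin k))
  choose g hg using fun i => (Submodule.mem_span_range_iff_exists_fun ℂ).1 (hqU i)
  have h1 := wronskianDet_sum_smul (Matrix.of g) f
  simp only [Matrix.of_apply, hg] at h1
  intro h0
  rw [h0, mul_zero] at h1
  exact wronskianDet_ne_zero_of_injective_natDegree hq0 hq.injective h1

end OscSchubert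

end

/-! ### The rational normal curve as a curve of powers of linear forms. -/

noncomputable section
namespace OscSchubert
open Polynomial

namespace RationalNormalCurve

variable {n : ℕ} (γ : RationalNormalCurve n)

/-- The monomial `s^(n-1-m) t^m` as a binary form. -/
def binaryMonomial (n : ℕ) (m : Fin (n - 1 + 1)) :
    MvPolynomial.homogeneousSubmodule (Fin 2) ℂ (n - 1) :=
  ⟨MvPolynomial.X 0 ^ (n - 1 - (m : ℕ)) * MvPolynomial.X 1 ^ (m : ℕ), by
    have := (MvPolynomial.isHomogeneous_X_pow (R := ℂ) (0 : Fin 2) (n - 1 - (m : ℕ))).mul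
      (MvPolynomial.isHomogeneous_X_pow (R := ℂ) (1 : Fin 2) (m : ℕ))
    rwa [Nat.sub_add_cancel (Nat.lt_succ_iff.1 m.2)] at this⟩

/-- The coefficient polynomials of `(t - s x)^(n-1)`, with `x` the variable, in the basis `γ`. -/
def dualCurve (j : Fin n) : ℂ[X] :=
  ∑ m : Fin (n - 1 + 1), γ.repr (binaryMonomial n m) j •
    ((-X) ^ (n - 1 - (m : ℕ)) * ((n - 1).choose m : ℂ[X]))

/-- The linear map `ℂⁿ → ℂ[X]` which takes `γ(s, t)` to `(t - s X)^(n-1)`. -/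
def toPoly : (Fin n → ℂ) →ₗ[ℂ] ℂ[X] := Fintype.linearCombination ℂ γ.dualCurve

theorem toPoly_apply (v : Fin n → ℂ) : γ.toPoly v = ∑ j, v j • γ.dualCurve j := rfl

theorem toPoly_mem_degreeLT (hn : 0 < n) (v : Fin n → ℂ) : γ.toPoly v ∈ degreeLT ℂ n := by
  rw [toPoly_apply]
  refine Submodule.sum_mem _ fun j _ => Submodule.smul_mem _ _ (Submodule.sum_mem _ fun m _ =>
    Submodule.smul_mem _ _ ?_)
  rw [mem_degreeLT, mul_comm, ← nsmul_eq_mul]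
  refine (degree_smul_le _ _).trans_lt ?_
  rw [neg_pow, ← C_1, ← C_neg, ← C_pow]
  refine (degree_C_mul_X_pow_le _ _).trans_lt ?_
  exact_mod_cast (Nat.sub_le _ _).trans_lt (Nat.sub_lt hn one_pos)

theorem sum_repr_localParam_coe (t : ℂ) (m : Fin (n - 1 + 1)) :
    ∑ j, γ.repr (binaryMonomial n m) j • γ.localParam (t : OnePoint ℂ) j = X ^ (m : ℕ) := by
  have h := congrArg Subtype.val (γ.sum_repr (binaryMonomial n m))
  rw [AddSubmonoidClass.coe_finsetSum] at h
  have h1 := congrArg (MvPolynomial.aeval ![1, (X : ℂ[X])]) h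
  rw [map_sum] at h1
  simp only [Submodule.coe_smul, map_smul] at h1
  refine Eq.trans h1 ?_
  simp [binaryMonomial]

theorem sum_repr_localParam_infty (m : Fin (n - 1 + 1)) :
    ∑ j, γ.repr (binaryMonomial n m) j • γ.localParam OnePoint.infty j
      = X ^ (n - 1 - (m : ℕ)) := by
  have h := congrArg Subtype.val (γ.sum_repr (binaryMonomial n m))
  rw [AddSubmonoidClass.coe_finsetSum] at h
  have h1 := congrArg (MvPolynomial.aeval ![(X : ℂ[X]), 1]) h
  rw [map_sum] at h1
  simp only [Submodule.coe_smul, map_smul] at h1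
  refine Eq.trans h1 ?_
  simp [binaryMonomial]

theorem toPoly_deriv (r : ℕ) (a : OnePoint ℂ) : γ.toPoly (γ.deriv r a) =
    ∑ m : Fin (n - 1 + 1), (derivative^[r]
      (∑ j, γ.repr (binaryMonomial n m) j • γ.localParam a j)).eval (localValue a) •
        ((-X) ^ (n - 1 - (m : ℕ)) * ((n - 1).choose m : ℂ[X])) := by
  simp only [toPoly_apply, dualCurve, Finset.smul_sum]
  rw [Finset.sum_comm]
  refine Finset.sum_congr rfl fun m _ => ?_
  rw [iterate_derivative_sum, eval_finsetSum, Finset.sum_smul]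
  refine Finset.sum_congr rfl fun j _ => ?_
  rw [iterate_derivative_smul, eval_smul, smul_smul, smul_eq_mul, mul_comm]
  rfl

theorem toPoly_deriv_coe (r : ℕ) (t : ℂ) : γ.toPoly (γ.deriv r (t : OnePoint ℂ)) =
    ((n - 1).descFactorial r : ℂ) • (C t - X) ^ (n - 1 - r) := by
  -- The outer variable is the parameter of the curve and the inner one is the variable of `toPoly`.
  -- The binomial expansion is differentiated `r` times in the outer variable and evaluated at `t`.
  have h1 : (X - C X : ℂ[X][X]) ^ (n - 1) = ∑ m : Fin (n - 1 + 1),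
      X ^ (m : ℕ) * C ((-X) ^ (n - 1 - (m : ℕ)) * ((n - 1).choose m : ℂ[X])) := by
    rw [sub_eq_add_neg, add_pow, Finset.sum_range]
    refine Finset.sum_congr rfl fun m _ => ?_
    simp [mul_assoc]
  have h2 := congrArg (fun q => (derivative^[r] q).eval (C t)) h1
  simp only [iterate_derivative_X_sub_pow, iterate_derivative_sum, eval_finsetSum,
    mul_comm _ (C _), iterate_derivative_C_mul] at h2
  simp only [toPoly_deriv, sum_repr_localParam_coe]
  rw [← C_mul', map_natCast, ← nsmul_eq_mul]
  refine Eq.trans (Finset.sum_congr rfl fun m _ => ?_) (h2.symm.trans ?_)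
  · change (derivative^[r] (X ^ (m : ℕ))).eval t • _ = _
    rw [iterate_derivative_X_pow_eq_smul, iterate_derivative_X_pow_eq_smul]
    simp only [eval_smul, eval_mul, eval_C, eval_pow, eval_X, smul_eq_mul]
    rw [smul_eq_C_mul, C_mul, C_pow, map_natCast, mul_comm]
  · simp

theorem toPoly_deriv_infty {r : ℕ} (hr : r < n) : ∃ c : ℂ, c ≠ 0 ∧
    γ.toPoly (γ.deriv r OnePoint.infty) = c • X ^ r := by
  have hr' : n - 1 - r < n - 1 + 1 := by omega
  refine ⟨r.factorial * ((-1) ^ r * (n - 1).choose (n - 1 - r)), ?_, ?_⟩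
  · have h1 : (n - 1).choose (n - 1 - r) ≠ 0 := Nat.choose_ne_zero (Nat.sub_le _ _)
    have h2 := Nat.factorial_ne_zero r
    exact mul_ne_zero (Nat.cast_ne_zero.2 h2)
      (mul_ne_zero (pow_ne_zero _ (by norm_num)) (Nat.cast_ne_zero.2 h1))
  · simp only [toPoly_deriv, sum_repr_localParam_infty]
    -- At `∞` only the monomial of degree exactly `r` in the local parameter survives `r`
    -- derivatives and evaluation at `0`.
    rw [Finset.sum_eq_single (⟨n - 1 - r, hr'⟩ : Fin (n - 1 + 1))]
    · change (derivative^[r] (X ^ (n - 1 - (n - 1 - r)))).eval 0 • _ = _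
      have : n - 1 - (n - 1 - r) = r := by omega
      simp only [this]
      rw [iterate_derivative_X_pow_eq_smul, neg_pow]
      simp [Nat.descFactorial_self, smul_eq_C_mul]
      ring
    · intro m _ hm
      change (derivative^[r] (X ^ (n - 1 - (m : ℕ)))).eval 0 • _ = _
      rw [iterate_derivative_X_pow_eq_smul]
      have hne : n - 1 - (m : ℕ) ≠ r := fun h => hm (Fin.ext (by have := m.2; simp only; omega))
      rcases lt_or_gt_of_ne hne with h | h
      · rw [Nat.descFactorial_of_lt h]
        simp
      · have : n - 1 - (m : ℕ) - r ≠ 0 := by omega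
        simp [this]
    · intro h
      exact absurd (Finset.mem_univ _) h

/-- The images have distinct degrees: `r` at `∞` and `n - 1 - r` at a finite point. -/
theorem linearIndependent_toPoly_deriv (a : OnePoint ℂ) :
    LinearIndependent ℂ fun r : Fin n => γ.toPoly (γ.deriv r a) := by
  induction a using OnePoint.rec with
  | infty =>
    choose c hc hcr using fun r : Fin n => γ.toPoly_deriv_infty r.2
    refine linearIndependent_of_injective_natDegree (fun r => ?_) fun r r' h => ?_
    · rw [hcr]
      exact smul_ne_zero (hc r) (pow_ne_zero _ X_ne_zero)
    · simp only [hcr, natDegree_smul _ (hc _), natDegree_X_pow] at h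
      exact Fin.ext h
  | coe t =>
    have hd : ∀ r : Fin n, ((n - 1).descFactorial r : ℂ) ≠ 0 := fun r => by
      have := r.2
      rw [Nat.cast_ne_zero, Ne, Nat.descFactorial_eq_zero_iff_lt]
      omega
    have hX : (C t - X : ℂ[X]) = -(X - C t) := by ring
    refine linearIndependent_of_injective_natDegree (fun r => ?_) fun r r' h => ?_
    · rw [toPoly_deriv_coe, hX]
      exact smul_ne_zero (hd r) (pow_ne_zero _ (neg_ne_zero.2 (X_sub_C_ne_zero t)))
    · simp only [toPoly_deriv_coe, natDegree_smul _ (hd _), natDegree_pow, hX, natDegree_neg,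
        natDegree_X_sub_C, mul_one] at h
      have := r.2
      have := r'.2
      exact Fin.ext (by omega)

theorem linearIndependent_deriv (a : OnePoint ℂ) :
    LinearIndependent ℂ fun r : Fin n => γ.deriv r a :=
  LinearIndependent.of_comp γ.toPoly (γ.linearIndependent_toPoly_deriv a)

theorem toPoly_injective (hn : 0 < n) : Function.Injective γ.toPoly := by
  have : Nonempty (Fin n) := ⟨⟨0, hn⟩⟩
  let b := basisOfLinearIndependentOfCardEqFinrank (γ.linearIndependent_deriv OnePoint.infty)
    (by simp)
  rw [← LinearMap.ker_eq_bot, LinearMap.ker_eq_bot']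
  intro v hv
  have h := γ.linearIndependent_toPoly_deriv OnePoint.infty
  rw [Fintype.linearIndependent_iff] at h
  have h1 := h (b.repr v) (by
    rw [← hv]
    conv_rhs => rw [← b.sum_repr v, map_sum]
    refine Finset.sum_congr rfl fun i _ => ?_
    rw [map_smul]
    simp [b])
  rw [← b.sum_repr v]
  exact Finset.sum_eq_zero fun i _ => by rw [h1 i, zero_smul]

theorem osculatingFlag_mono (a : OnePoint ℂ) : Monotone (γ.osculatingFlag a) := by
  intro i j hij
  refine Submodule.span_mono ?_
  rintro _ ⟨r, rfl⟩
  exact ⟨Fin.castLE hij r, rfl⟩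

theorem finrank_osculatingFlag (a : OnePoint ℂ) {i : ℕ} (hi : i ≤ n) :
    Module.finrank ℂ (γ.osculatingFlag a i) = i := by
  have := (γ.linearIndependent_deriv a).comp (Fin.castLE hi) (Fin.castLE_injective hi)
  exact (finrank_span_eq_card this).trans (Fintype.card_fin i)

/-- The generators `γ.deriv r t` with `r < i` go to multiples of `(C t - X) ^ (n - 1 - r)`, whose
exponent is at least `n - i`. -/
theorem pow_dvd_toPoly {i : ℕ} (hi : i ≤ n) {t : ℂ} {v : Fin n → ℂ}
    (hv : v ∈ γ.osculatingFlag (t : OnePoint ℂ) i) : (X - C t) ^ (n - i) ∣ γ.toPoly v := by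
  induction hv using Submodule.span_induction with
  | mem v hv =>
    obtain ⟨r, rfl⟩ := hv
    simp only
    have hX : (C t - X : ℂ[X]) = C (-1) * (X - C t) := by
      rw [map_neg, map_one]
      ring
    rw [toPoly_deriv_coe, smul_eq_C_mul, hX, mul_pow]
    have := r.2
    exact ((pow_dvd_pow _ (by omega)).mul_left _).mul_left _
  | zero => simp
  | add v w _ _ h1 h2 =>
    rw [map_add]
    exact dvd_add h1 h2
  | smul c v _ h =>
    rw [map_smul, smul_eq_C_mul]
    exact h.mul_left _

theorem toPoly_mem_degreeLT_of_mem_infty {i : ℕ} (hi : i ≤ n) {v : Fin n → ℂ}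
    (hv : v ∈ γ.osculatingFlag OnePoint.infty i) : γ.toPoly v ∈ degreeLT ℂ i := by
  suffices γ.osculatingFlag OnePoint.infty i ≤ (degreeLT ℂ i).comap γ.toPoly from this hv
  refine Submodule.span_le.2 ?_
  rintro _ ⟨r, rfl⟩
  obtain ⟨c, -, hc⟩ := γ.toPoly_deriv_infty (r.2.trans_le hi)
  simp only [Submodule.comap_coe, Set.mem_preimage, SetLike.mem_coe, hc]
  refine Submodule.smul_mem _ _ (mem_degreeLT.2 ?_)
  rw [degree_X_pow]
  exact_mod_cast r.2

end RationalNormalCurve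

end OscSchubert

end

/-! ### Upper bound: the Wronskian of a plane in osculating Schubert varieties. -/

noncomputable section
namespace OscSchubert
open Polynomial

variable {k n : ℕ}

theorem SchubertCondition.add_le (α : SchubertCondition k n) (m : ℕ) {i j : Fin k}
    (h : (j : ℕ) = i + m) : (α i : ℕ) + m ≤ α j := by
  induction m generalizing j with
  | zero =>
    have : j = i := Fin.ext h
    rw [this, add_zero]
  | succ m ih =>
    have hj := j.2
    have h1 := ih (j := ⟨i + m, by omega⟩) rfl
    have h2 : α ⟨i + m, by omega⟩ < α j := α.strictMono (Fin.lt_def.2 (by simp only; omega))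
    rw [Fin.lt_def] at h2
    omega

theorem SchubertCondition.le_apply (α : SchubertCondition k n) (i : Fin k) : (i : ℕ) ≤ α i := by
  have := α.add_le i (i := ⟨0, i.pos⟩) (j := i) (by simp)
  omega

theorem SchubertCondition.apply_add_le (α : SchubertCondition k n) (i : Fin k) :
    (α i : ℕ) + k ≤ n + i := by
  have hi := i.2
  have h1 := α.add_le (k - 1 - i) (i := i) (j := ⟨k - 1, by omega⟩) (by simp only; omega)
  have h2 := (α ⟨k - 1, by omega⟩).2
  omega

theorem SchubertCondition.size_add_sum (α : SchubertCondition k n) :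
    α.size + ∑ i, (α i : ℕ) = k * (n - k) + ∑ i : Fin k, (i : ℕ) := by
  have h1 : ∑ i : Fin k, ((α i : ℕ) - i) ≤ k * (n - k) := by
    refine (Finset.sum_le_card_nsmul Finset.univ _ (n - k) fun i _ => ?_).trans ?_
    · have := α.apply_add_le i
      omega
    · simp
  have h2 : ∑ i, (α i : ℕ) = ∑ i : Fin k, ((α i : ℕ) - i) + ∑ i : Fin k, (i : ℕ) := by
    rw [← Finset.sum_add_distrib]
    exact Finset.sum_congr rfl fun i _ => (Nat.sub_add_cancel (α.le_apply i)).symm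
  rw [h2, SchubertCondition.size]
  omega

/-- The right side adds up the vanishing orders at a finite point of a basis adapted to the flag.
The Wronskian loses `∑ i` of them to differentiation and keeps `α.size`. -/
theorem sum_sub_apply_eq (hk : 0 < k) (hkn : k ≤ n) (α : SchubertCondition k n) :
    α.size + ∑ i : Fin k, (i : ℕ) = ∑ i, (n - ((α i : ℕ) + 1)) := by
  have h1 : ∑ i, (n - ((α i : ℕ) + 1)) + ∑ i, (α i : ℕ) = k * (n - 1) := by
    rw [← Finset.sum_add_distrib, Finset.sum_congr rfl fun i _ =>
      show n - ((α i : ℕ) + 1) + (α i : ℕ) = n - 1 by have := (α i).2; omega]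
    simp
  have h2 : (∑ i : Fin k, (i : ℕ)) * 2 = k * (k - 1) := by
    rw [Fin.sum_univ_eq_sum_range (fun i => i), Finset.sum_range_id_mul_two]
  have h3 : k * (n - 1) = k * (n - k) + k * (k - 1) := by
    rw [← mul_add]
    congr 1
    omega
  have := α.size_add_sum
  omega

/-- The Schubert condition that every `k`-plane satisfies. -/
def SchubertCondition.trivial (hkn : k ≤ n) : SchubertCondition k n :=
  OrderEmbedding.ofStrictMono (fun i => ⟨n - k + i, by have := i.2; omega⟩) fun _ _ h =>
    Fin.lt_def.2 (Nat.add_lt_add_left (Fin.lt_def.1 h) _)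

theorem SchubertCondition.trivial_apply (hkn : k ≤ n) (i : Fin k) :
    (SchubertCondition.trivial hkn i : ℕ) = n - k + i := rfl

theorem SchubertCondition.size_trivial (hkn : k ≤ n) : (trivial hkn).size = 0 := by
  have := (trivial hkn).size_add_sum
  simp only [trivial_apply, Finset.sum_add_distrib, Finset.sum_const, Finset.card_univ,
    Fintype.card_fin, smul_eq_mul] at this
  omega

theorem osculatingSchubertVariety_trivial (hkn : k ≤ n) (γ : RationalNormalCurve n)
    (a : OnePoint ℂ) :
    osculatingSchubertVariety γ (SchubertCondition.trivial hkn) a = Set.univ := by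
  refine Set.eq_univ_of_forall fun H i => ?_
  have hi := i.2
  rw [SchubertCondition.trivial_apply]
  have h1 := Submodule.finrank_sup_add_finrank_inf_eq H.1 (γ.osculatingFlag a (n - k + i + 1))
  have h2 := Submodule.finrank_le (H.1 ⊔ γ.osculatingFlag a (n - k + i + 1))
  rw [Module.finrank_fin_fun] at h2
  rw [H.2, γ.finrank_osculatingFlag a (by omega)] at h1
  omega

namespace RationalNormalCurve

variable (γ : RationalNormalCurve n)

/-- The Wronskian of the polynomials that correspond to the rows of a matrix. -/
def rowWronskian (M : Matrix (Fin k) (Fin n) ℂ) : ℂ[X] := wronskianDet fun i => γ.toPoly (M i)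

theorem rowWronskian_mul (g : Matrix (Fin k) (Fin k) ℂ) (M : Matrix (Fin k) (Fin n) ℂ) :
    γ.rowWronskian (g * M) = C g.det * γ.rowWronskian M := by
  rw [rowWronskian, rowWronskian, ← wronskianDet_sum_smul]
  congr 1
  funext i
  rw [Matrix.mul_apply_eq_vecMul, Matrix.vecMul_eq_sum, map_sum]
  simp only [map_smul]

/-- This exhibits vanishing of the Wronskian at `b` as a linear condition on Plücker coordinates,
through `pluckerForm`. -/
theorem eval_rowWronskian (M : Matrix (Fin k) (Fin n) ℂ) (b : ℂ) :
    (γ.rowWronskian M).eval b =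
      (M * Matrix.of fun s (j : Fin k) => (derivative^[j] (γ.dualCurve s)).eval b).det := by
  rw [rowWronskian, wronskianDet, ← coe_evalRingHom, RingHom.map_det]
  congr 1
  ext i j
  simp [Matrix.mul_apply, toPoly_apply, iterate_derivative_sum, iterate_derivative_smul,
    eval_finsetSum]

theorem rowWronskian_ne_zero (hn : 0 < n) {M : Matrix (Fin k) (Fin n) ℂ}
    (hM : LinearIndependent ℂ M.row) : γ.rowWronskian M ≠ 0 :=
  wronskianDet_ne_zero (hM.map' γ.toPoly (LinearMap.ker_eq_bot.2 (γ.toPoly_injective hn)))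
    fun i => γ.toPoly_mem_degreeLT hn (M i)

/-- Passing to a basis adapted to the flag changes the Wronskian only by the nonzero determinant of
the base change. -/
theorem exists_rowWronskian_eq {α : SchubertCondition k n} {a : OnePoint ℂ} {H : Gr k n}
    (hH : H ∈ osculatingSchubertVariety γ α a) {M : Matrix (Fin k) (Fin n) ℂ}
    (hM : rowSpace M = H.1) : ∃ (M' : Matrix (Fin k) (Fin n) ℂ) (c : ℂ), c ≠ 0 ∧
      γ.rowWronskian M' = C c * γ.rowWronskian M ∧
      ∀ i, M' i ∈ γ.osculatingFlag a ((α i : ℕ) + 1) := by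
  obtain ⟨M', hM', h⟩ := (mem_schubertVariety_iff (γ.osculatingFlag_mono a)).1 hH
  obtain ⟨g, hg, rfl⟩ := exists_eq_mul_of_rowSpace_eq hM hM'
  exact ⟨_, g.det, hg, γ.rowWronskian_mul g M, h⟩

theorem pow_size_dvd_rowWronskian (hk : 0 < k) (hkn : k ≤ n) {α : SchubertCondition k n} {t : ℂ}
    {H : Gr k n} (hH : H ∈ osculatingSchubertVariety γ α (t : OnePoint ℂ))
    {M : Matrix (Fin k) (Fin n) ℂ} (hM : rowSpace M = H.1) :
    (X - C t) ^ α.size ∣ γ.rowWronskian M := by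
  obtain ⟨M', c, hc, hW, hF⟩ := γ.exists_rowWronskian_eq hH hM
  have h1 : (X - C t) ^ α.size ∣ γ.rowWronskian M' :=
    pow_dvd_wronskianDet (fun i => γ.pow_dvd_toPoly (Nat.succ_le_of_lt (α i).2) (hF i))
      (sum_sub_apply_eq hk hkn α)
  rw [hW] at h1
  exact ((isUnit_C.2 hc.isUnit).dvd_mul_left).1 h1

theorem natDegree_rowWronskian_add_size_le (hn : 0 < n) {α : SchubertCondition k n} {H : Gr k n}
    (hH : H ∈ osculatingSchubertVariety γ α OnePoint.infty) {M : Matrix (Fin k) (Fin n) ℂ}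
    (hM : rowSpace M = H.1) : (γ.rowWronskian M).natDegree + α.size ≤ k * (n - k) := by
  obtain ⟨M', c, hc, hW, hF⟩ := γ.exists_rowWronskian_eq hH hM
  have h0 := γ.rowWronskian_ne_zero hn (linearIndependent_of_rowSpace hM)
  have h1 : (γ.rowWronskian M').natDegree + ∑ j : Fin k, (j : ℕ) ≤ ∑ i, (α i : ℕ) := by
    refine natDegree_wronskianDet_add_le (fun i => ?_) ?_
    · have := γ.toPoly_mem_degreeLT_of_mem_infty (Nat.succ_le_of_lt (α i).2) (hF i)
      exact natDegree_le_of_degree_le (Order.lt_succ_iff.1 (mem_degreeLT.1 this))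
    · change γ.rowWronskian M' ≠ 0
      rw [hW]
      exact mul_ne_zero (C_ne_zero.2 hc) h0
  rw [hW, natDegree_C_mul hc] at h1
  have := α.size_add_sum
  omega

end RationalNormalCurve

theorem natDegree_prod_X_sub_C_pow_le {ι : Type*} {s : Finset ι} {u : ι → ℂ}
    (hu : Set.InjOn u s) (e : ι → ℕ) {p : ℂ[X]} (hp : p ≠ 0)
    (h : ∀ i ∈ s, (X - C (u i)) ^ e i ∣ p) : ∑ i ∈ s, e i ≤ p.natDegree := by
  have h1 : ∏ i ∈ s, (X - C (u i)) ^ e i ∣ p :=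
    Finset.prod_dvd_of_coprime (fun i hi j hj hij => (isCoprime_X_sub_C_of_isUnit_sub
      (sub_ne_zero.2 fun h => hij (hu hi hj h)).isUnit).pow) h
  have h2 := natDegree_le_of_dvd h1 hp
  rw [natDegree_prod _ _ fun i _ => pow_ne_zero _ (X_sub_C_ne_zero _)] at h2
  simpa using h2

open TopologicalSpace in
/-- Chains of irreducible closed subsets in an intersection of osculating Schubert varieties at
distinct points are not longer than the expected dimension. -/
theorem length_add_sum_size_le (hk : 0 < k) (hkn : k ≤ n) (γ : RationalNormalCurve n)
    {ι : Type*} [Fintype ι] {α : ι → SchubertCondition k n} {a : ι → OnePoint ℂ}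
    (ha : Function.Injective a) (l : LTSeries (IrreducibleCloseds (Gr k n)))
    (hl : (l.last : Set (Gr k n)) ⊆ ⋂ i, osculatingSchubertVariety γ (α i) (a i)) :
    l.length + ∑ i, (α i).size ≤ k * (n - k) := by
  classical
  have hn : 0 < n := hk.trans_le hkn
  have hfin : {t : ℂ | ∃ i, a i = t}.Finite := by
    refine (Set.finite_range fun i => localValue (a i)).subset ?_
    rintro t ⟨i, hi⟩
    exact ⟨i, by simp only [hi]; rfl⟩
  -- Distinct auxiliary points away from the finite `a i`, where the Wronskian is forced to vanish
  -- by hyperplane sections.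
  let b := hfin.infinite_compl.natEmbedding
  obtain ⟨H, hHl, hH⟩ := exists_mem_last_forall_notMem_nonvanishing hk l
    (fun q => pluckerForm (Matrix.of fun s (j : Fin k) =>
      (derivative^[j] (γ.dualCurve s)).eval (b q : ℂ))) fun q => isHomogeneous_pluckerForm _
  obtain ⟨M, hM⟩ := exists_rowSpace_eq H
  have hX : ∀ i, H ∈ osculatingSchubertVariety γ (α i) (a i) := Set.mem_iInter.1 (hl hHl)
  have hW := γ.rowWronskian_ne_zero hn (linearIndependent_of_rowSpace hM)
  have hb : ∀ q : Fin l.length, (γ.rowWronskian M).eval (b q : ℂ) = 0 := fun q => by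
    have := hH q
    rwa [Gr.mem_nonvanishing_iff (isHomogeneous_pluckerForm _) hM, not_not, eval_pluckerForm,
      ← γ.eval_rowWronskian] at this
  let s : Finset ι := Finset.univ.filter fun i => a i ≠ OnePoint.infty
  have hs : ∀ i ∈ s, a i = (localValue (a i) : OnePoint ℂ) := fun i hi => by
    obtain ⟨t, ht⟩ := OnePoint.ne_infty_iff_exists.1 (Finset.mem_filter.1 hi).2
    rw [← ht]
    rfl
  -- Roots of the Wronskian: the finite `a i` with multiplicity at least `(α i).size`, and the
  -- points `b q` with multiplicity at least one.
  have h1 := natDegree_prod_X_sub_C_pow_le (s := s.disjSum (Finset.univ : Finset (Fin l.length)))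
    (u := Sum.elim (fun i => localValue (a i)) fun q => (b q : ℂ)) (by
      rintro (i | i) hi (j | j) hj hij
      · have hi' := hs i (by simpa using hi)
        have hj' := hs j (by simpa using hj)
        simp only [Sum.elim_inl] at hij
        rw [hij, ← hj'] at hi'
        rw [ha hi']
      · have hi' := hs i (by simpa using hi)
        simp only [Sum.elim_inl, Sum.elim_inr] at hij
        exact absurd ⟨i, by rw [hi', hij]⟩ (b j).2
      · have hj' := hs j (by simpa using hj)
        simp only [Sum.elim_inl, Sum.elim_inr] at hij
        exact absurd ⟨j, by rw [hj', hij]⟩ (b i).2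
      · simp only [Sum.elim_inr] at hij
        rw [Fin.ext (b.injective (Subtype.ext hij))])
    (Sum.elim (fun i => (α i).size) fun _ => 1) hW (by
      rintro (i | q) hi
      · have hi' := hs i (by simpa using hi)
        have := hX i
        rw [hi'] at this
        exact γ.pow_size_dvd_rowWronskian hk hkn this hM
      · simp only [Sum.elim_inr, pow_one]
        exact dvd_iff_isRoot.2 (hb q))
  rw [Finset.sum_disjSum] at h1
  simp only [Sum.elim_inl, Sum.elim_inr, Finset.sum_const, Finset.card_univ, Fintype.card_fin,
    smul_eq_mul, mul_one] at h1
  have h2 : (γ.rowWronskian M).natDegree +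
      ∑ i ∈ Finset.univ.filter (fun i => ¬ a i ≠ OnePoint.infty), (α i).size ≤ k * (n - k) := by
    by_cases hinf : ∃ i, a i = OnePoint.infty
    · obtain ⟨i, hi⟩ := hinf
      have : Finset.univ.filter (fun i => ¬ a i ≠ OnePoint.infty) = {i} := by
        ext j
        simp only [Finset.mem_filter, Finset.mem_univ, true_and, not_not, Finset.mem_singleton]
        exact ⟨fun hj => ha (hj.trans hi.symm), fun hj => hj ▸ hi⟩
      rw [this, Finset.sum_singleton]
      have := hX i
      rw [hi] at this
      exact γ.natDegree_rowWronskian_add_size_le hn this hM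
    -- If no `a i` is `∞`, the trivial condition at `∞` still gives the degree bound `k * (n - k)`.
    · rw [Finset.filter_false_of_mem fun i _ h => hinf ⟨i, not_not.1 h⟩, Finset.sum_empty]
      have hH' : H ∈ osculatingSchubertVariety γ (SchubertCondition.trivial hkn) OnePoint.infty :=
        osculatingSchubertVariety_trivial hkn γ _ ▸ Set.mem_univ H
      have := γ.natDegree_rowWronskian_add_size_le hn hH' hM
      rwa [SchubertCondition.size_trivial] at this
  have h3 := Finset.sum_filter_add_sum_filter_not Finset.univ (fun i => a i ≠ OnePoint.infty)
    fun i => (α i).size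
  change ∑ i ∈ s, (α i).size + _ = _ at h3
  omega

end OscSchubert

end

/-! ### Lower bound: parametrization by echelon matrices and its dimension. -/

noncomputable section
namespace OscSchubert
open MvPolynomial

variable {k n : ℕ} {ι : Type}

section stiefelMap

variable {R S : Type*} [CommRing R] [Algebra ℂ R] [CommRing S] [Algebra ℂ S]

/-- The algebra homomorphism which takes the generic family of `k × n` matrices to the family of
the products `G i * A i * E i`. -/
def stiefelMap (E : ι → Matrix (Fin n) (Fin n) ℂ) (G : ι → Matrix (Fin k) (Fin k) R)
    (A : ι → Matrix (Fin k) (Fin n) R) : MvPolynomial (ι × Fin k × Fin n) ℂ →ₐ[ℂ] R :=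
  aeval fun x => (G x.1 * A x.1 * (E x.1).map (algebraMap ℂ R)) x.2.1 x.2.2

theorem comp_stiefelMap (ρ : R →ₐ[ℂ] S) (E : ι → Matrix (Fin n) (Fin n) ℂ)
    (G : ι → Matrix (Fin k) (Fin k) R) (A : ι → Matrix (Fin k) (Fin n) R) :
    ρ.comp (stiefelMap E G A) = stiefelMap E (fun i => (G i).map ρ) (fun i => (A i).map ρ) := by
  refine algHom_ext fun x => ?_
  simp only [stiefelMap, AlgHom.comp_apply, aeval_X]
  simp [Matrix.mul_apply]

end stiefelMap

/-- The variables of the generic matrices `G i` and `A i`. -/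
abbrev EchelonVar (k n : ℕ) (ι : Type) : Type := ι × (Fin k × Fin k ⊕ Fin k × Fin n)

/-- The generic square matrices. -/
def genericSquare (i : ι) : Matrix (Fin k) (Fin k) (MvPolynomial (EchelonVar k n ι) ℂ) :=
  Matrix.of fun r s => X (i, Sum.inl (r, s))

/-- The generic matrices in row echelon form of shape `α`. -/
def genericEchelon (α : ι → SchubertCondition k n) (i : ι) :
    Matrix (Fin k) (Fin n) (MvPolynomial (EchelonVar k n ι) ℂ) :=
  Matrix.of fun j l => if l ≤ α i j then X (i, Sum.inr (j, l)) else 0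

/-- The variables of the generic matrices in reduced row echelon form. -/
abbrev ReducedVar (α : ι → SchubertCondition k n) : Type :=
  Σ i : ι, (Fin k × Fin k ⊕ {p : Fin k × Fin n // p.2 < α i p.1 ∧ p.2 ∉ Set.range (α i)})

/-- The generic square matrices, in the variables of the reduced echelon form. -/
def reducedSquare (α : ι → SchubertCondition k n) (i : ι) :
    Matrix (Fin k) (Fin k) (MvPolynomial (ReducedVar α) ℂ) :=
  Matrix.of fun r s => X ⟨i, Sum.inl (r, s)⟩

open Classical in
/-- The generic matrices in reduced row echelon form, with pivots in the columns `α`. -/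
def reducedEchelon (α : ι → SchubertCondition k n) (i : ι) :
    Matrix (Fin k) (Fin n) (MvPolynomial (ReducedVar α) ℂ) :=
  Matrix.of fun j l => if h : l < α i j ∧ l ∉ Set.range (α i) then X ⟨i, Sum.inr ⟨(j, l), h⟩⟩
    else if l = α i j then 1 else 0

theorem reducedEchelon_apply_pivot (α : ι → SchubertCondition k n) (i : ι) (j j' : Fin k) :
    reducedEchelon α i j (α i j') = if j = j' then 1 else 0 := by
  simp [reducedEchelon, eq_comm]

/-- The reduced form is a specialization of the generic one. The generic form reaches every matrix
that represents a plane of the Schubert variety, while the reduced form has no superfluous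
parameters and serves to count dimensions. -/
theorem ker_stiefelMap_le (E : ι → Matrix (Fin n) (Fin n) ℂ) (α : ι → SchubertCondition k n) :
    RingHom.ker (stiefelMap E genericSquare (genericEchelon α)) ≤
      RingHom.ker (stiefelMap E (reducedSquare α) (reducedEchelon α)) := by
  let ρ : MvPolynomial (EchelonVar k n ι) ℂ →ₐ[ℂ] MvPolynomial (ReducedVar α) ℂ :=
    aeval fun x => Sum.elim (fun y => reducedSquare α x.1 y.1 y.2)
      (fun y => reducedEchelon α x.1 y.1 y.2) x.2
  have hG : (fun i => (genericSquare i).map ρ) = reducedSquare α := by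
    funext i
    ext1 r s
    simp [genericSquare, ρ]
  have hA : (fun i => (genericEchelon α i).map ρ) = reducedEchelon α := by
    funext i
    ext1 j l
    simp only [genericEchelon, Matrix.map_apply, Matrix.of_apply]
    split_ifs with h
    · simp [ρ]
    · have h1 : ¬ l < α i j := fun hl => h hl.le
      have h2 : l ≠ α i j := fun hl => h hl.le
      simp [reducedEchelon, h1, h2]
  have h := comp_stiefelMap ρ E genericSquare (genericEchelon α)
  rw [hG, hA] at h
  intro p hp
  rw [RingHom.mem_ker] at hp ⊢
  rw [← h, AlgHom.comp_apply, hp, map_zero]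

theorem isAlgebraic_of_mul_eq {R A : Type*} [CommRing R] [CommRing A] [Algebra R A]
    [FaithfulSMul R A] {c b : R} {y : A} (hc : c ≠ 0)
    (h : algebraMap R A c * y = algebraMap R A b) : IsAlgebraic R y := by
  refine ⟨Polynomial.C c * Polynomial.X - Polynomial.C b, fun h0 => hc ?_, by simp [h]⟩
  have := congrArg (fun q => Polynomial.coeff q 1) h0
  simpa [Polynomial.coeff_C] using this

theorem det_reducedSquare_ne_zero (α : ι → SchubertCondition k n) (i : ι) :
    (reducedSquare α i).det ≠ 0 := fun h => by
  have h1 := congrArg (aeval (R := ℂ) fun y : ReducedVar α =>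
    Sum.elim (fun p => if p.1 = p.2 then (1 : ℂ) else 0) (fun _ => 0) y.2) h
  rw [AlgHom.map_det, map_zero] at h1
  have h2 : (aeval (R := ℂ) fun y : ReducedVar α =>
      Sum.elim (fun p => if p.1 = p.2 then (1 : ℂ) else 0) (fun _ => 0) y.2).mapMatrix
        (reducedSquare α i) = 1 := by
    ext r s
    simp [reducedSquare, Matrix.one_apply]
  rw [h2, Matrix.det_one] at h1
  exact one_ne_zero h1

/-- The parameters can be recovered from the product: cancel the invertible `E`, read `G` off the
pivot columns of `G * A`, then solve for `A` with the adjugate of `G`. So the parametrization loses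
no dimension. -/
theorem isAlgebraic_range_stiefelMap {E : ι → Matrix (Fin n) (Fin n) ℂ}
    (hE : ∀ i, IsUnit (E i).det) (α : ι → SchubertCondition k n) :
    Algebra.IsAlgebraic (stiefelMap E (reducedSquare α) (reducedEchelon α)).range
      (MvPolynomial (ReducedVar α) ℂ) := by
  set B := (stiefelMap E (reducedSquare α) (reducedEchelon α)).range
  have hmem : ∀ i j l, (reducedSquare α i * reducedEchelon α i) j l ∈ B := fun i j l => by
    let c : ℂ →+* MvPolynomial (ReducedVar α) ℂ := algebraMap ℂ _
    let N : Matrix (Fin k) (Fin n) (MvPolynomial (ReducedVar α) ℂ) :=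
      reducedSquare α i * reducedEchelon α i
    have h0 : (E i).map c * (E i)⁻¹.map c = 1 := by
      rw [← Matrix.map_mul, Matrix.mul_nonsing_inv _ (hE i),
        Matrix.map_one _ (map_zero _) (map_one _)]
    have h1 : N = N * (E i).map c * (E i)⁻¹.map c := by
      rw [Matrix.mul_assoc, h0, Matrix.mul_one]
    change N j l ∈ B
    rw [h1, Matrix.mul_apply]
    refine B.sum_mem fun s _ => B.mul_mem ⟨X (i, j, s), ?_⟩ (B.algebraMap_mem _)
    simp [stiefelMap, N, c]
  have hGmem : ∀ i r s, reducedSquare α i r s ∈ B := fun i r s => by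
    have := hmem i r (α i s)
    rw [Matrix.mul_apply] at this
    simpa [reducedEchelon_apply_pivot] using this
  have halg : ∀ y : ReducedVar α, IsAlgebraic B (X y : MvPolynomial (ReducedVar α) ℂ) := by
    rintro ⟨i, ⟨r, s⟩ | ⟨⟨j, l⟩, hjl⟩⟩
    · exact isAlgebraic_algebraMap (⟨reducedSquare α i r s, hGmem i r s⟩ : B)
    · let G' : Matrix (Fin k) (Fin k) B := Matrix.of fun r s => ⟨reducedSquare α i r s, hGmem i r s⟩
      let N' : Matrix (Fin k) (Fin n) B := Matrix.of fun j l =>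
        ⟨(reducedSquare α i * reducedEchelon α i) j l, hmem i j l⟩
      have hG' : (algebraMap B (MvPolynomial (ReducedVar α) ℂ)).mapMatrix G' = reducedSquare α i :=
        rfl
      have hdet : algebraMap B (MvPolynomial (ReducedVar α) ℂ) G'.det = (reducedSquare α i).det := by
        rw [RingHom.map_det, hG']
      refine isAlgebraic_of_mul_eq (c := G'.det) (b := (G'.adjugate * N') j l) (fun h0 => ?_) ?_
      · rw [h0, map_zero] at hdet
        exact det_reducedSquare_ne_zero α i hdet.symm
      · have h1 : (G'.adjugate * N').map (algebraMap B (MvPolynomial (ReducedVar α) ℂ)) =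
            (reducedSquare α i).det • reducedEchelon α i := by
          rw [Matrix.map_mul]
          have h2 : G'.adjugate.map (algebraMap B (MvPolynomial (ReducedVar α) ℂ)) =
              (reducedSquare α i).adjugate := by
            rw [← hG', ← RingHom.map_adjugate]
            rfl
          have h3 : N'.map (algebraMap B (MvPolynomial (ReducedVar α) ℂ)) =
              reducedSquare α i * reducedEchelon α i := rfl
          rw [h2, h3, ← Matrix.mul_assoc, Matrix.adjugate_mul, Matrix.smul_mul, Matrix.one_mul]
        have h2 := congrFun (congrFun h1 j) l
        rw [Matrix.map_apply, Matrix.smul_apply, smul_eq_mul] at h2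
        rw [h2, hdet]
        congr 1
        simp only [reducedEchelon, Matrix.of_apply]
        rw [dif_pos hjl]
  refine ⟨fun p => ?_⟩
  induction p using MvPolynomial.induction_on with
  | C c => exact isAlgebraic_algebraMap (algebraMap ℂ B c)
  | add p q hp hq => exact hp.add hq
  | mul_X p y hp => exact hp.mul (halg y)

/-- For each index, `G` has `k * k` entries, and row `j` of the reduced form has `α j - j` free
ones: the columns before the pivot, without the `j` earlier pivots. -/
theorem card_reducedVar [Fintype ι] (hkn : k ≤ n) (α : ι → SchubertCondition k n) :
    Nat.card (ReducedVar α) + ∑ i, (α i).size = Fintype.card ι * (k * n) := by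
  classical
  have h1 : ∀ i, Fintype.card {p : Fin k × Fin n // p.2 < α i p.1 ∧ p.2 ∉ Set.range (α i)}
      + ∑ j : Fin k, (j : ℕ) = ∑ j, (α i j : ℕ) := fun i => by
    have e : {p : Fin k × Fin n // p.2 < α i p.1 ∧ p.2 ∉ Set.range (α i)} ≃
        Σ j : Fin k, {l : Fin n // l < α i j ∧ l ∉ Set.range (α i)} :=
      { toFun := fun p => ⟨p.1.1, p.1.2, p.2⟩
        invFun := fun p => ⟨(p.1, p.2.1), p.2.2⟩
        left_inv := fun _ => rfl
        right_inv := fun _ => rfl }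
    rw [Fintype.card_congr e, Fintype.card_sigma, ← Finset.sum_add_distrib]
    refine Finset.sum_congr rfl fun j _ => ?_
    rw [Fintype.card_subtype]
    have h2 : Finset.univ.filter (fun l => l < α i j ∧ l ∉ Set.range (α i)) =
        Finset.Iio (α i j) \ (Finset.Iio j).map (α i).toEmbedding := by
      ext l
      simp only [Finset.mem_filter, Finset.mem_univ, true_and, Finset.mem_sdiff, Finset.mem_Iio,
        Finset.mem_map, Set.mem_range, not_exists]
      refine and_congr_right fun hl => ⟨fun h j' hj' => h j' hj'.2, fun h j' hj' => h j' ⟨?_, hj'⟩⟩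
      exact (α i).lt_iff_lt.1 (hj' ▸ hl)
    rw [h2, Finset.card_sdiff_of_subset, Finset.card_map, Fin.card_Iio, Fin.card_Iio]
    · exact Nat.sub_add_cancel ((α i).le_apply j)
    · intro l hl
      obtain ⟨j', hj', rfl⟩ := Finset.mem_map.1 hl
      exact Finset.mem_Iio.2 ((α i).strictMono (Finset.mem_Iio.1 hj'))
  rw [Nat.card_eq_fintype_card, Fintype.card_sigma, ← Finset.sum_add_distrib]
  have h3 : k * k + k * (n - k) = k * n := by
    rw [← mul_add]
    congr 1
    omega
  rw [Finset.sum_congr rfl fun i _ => show _ = k * n from ?_, Finset.sum_const, Finset.card_univ,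
    smul_eq_mul]
  rw [Fintype.card_sum, Fintype.card_prod, Fintype.card_fin]
  have := h1 i
  have := (α i).size_add_sum
  omega

/-- The range of the reduced parametrization is a quotient of this coordinate ring, and its
transcendence degree is the number of parameters. -/
theorem card_reducedVar_le_trdeg [Finite ι] {E : ι → Matrix (Fin n) (Fin n) ℂ}
    (hE : ∀ i, IsUnit (E i).det) (α : ι → SchubertCondition k n) :
    (Nat.card (ReducedVar α) : Cardinal) ≤ Algebra.trdeg ℂ (MvPolynomial (ι × Fin k × Fin n) ℂ ⧸
      RingHom.ker (stiefelMap E genericSquare (genericEchelon α))) := by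
  let ψ := stiefelMap E (reducedSquare α) (reducedEchelon α)
  have := isAlgebraic_range_stiefelMap hE α
  have h1 : Algebra.trdeg ℂ ψ.range = Nat.card (ReducedVar α) := by
    have : FaithfulSMul ℂ ψ.range :=
      (faithfulSMul_iff_algebraMap_injective _ _).2 (algebraMap ℂ ψ.range).injective
    have := trdeg_add_eq ℂ ψ.range (A := MvPolynomial (ReducedVar α) ℂ)
    rw [trdeg_eq_zero (R := ψ.range), add_zero, MvPolynomial.trdeg_of_isDomain] at this
    rw [this, Cardinal.lift_id, Nat.cast_card]
  rw [← h1]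
  refine trdeg_le_of_surjective (Ideal.Quotient.liftₐ _ ψ.rangeRestrict fun p hp => ?_)
    (Ideal.Quotient.lift_surjective_of_surjective _ _ ψ.rangeRestrict_surjective)
  exact Subtype.ext (ker_stiefelMap_le E α hp)

end OscSchubert

end

/-! ### Zeros of the ideal of the parametrized family. -/

noncomputable section
namespace OscSchubert
open MvPolynomial

variable {k n : ℕ} {ι : Type}

/-- The matrix whose rows are the derivatives of the curve at a point. -/
def RationalNormalCurve.derivMatrix (γ : RationalNormalCurve n) (a : OnePoint ℂ) :
    Matrix (Fin n) (Fin n) ℂ :=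
  Matrix.of fun r => γ.deriv r a

theorem RationalNormalCurve.isUnit_det_derivMatrix (γ : RationalNormalCurve n) (a : OnePoint ℂ) :
    IsUnit (γ.derivMatrix a).det := by
  rw [← Matrix.isUnit_iff_isUnit_det, ← Matrix.linearIndependent_rows_iff_isUnit]
  exact γ.linearIndependent_deriv a

theorem RationalNormalCurve.mem_osculatingFlag_iff {γ : RationalNormalCurve n} {a : OnePoint ℂ}
    {l : Fin n} {v : Fin n → ℂ} : v ∈ γ.osculatingFlag a ((l : ℕ) + 1) ↔
      ∃ c : Fin n → ℂ, (∀ l', l < l' → c l' = 0) ∧ v = Matrix.vecMul c (γ.derivMatrix a) := by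
  have hsum : ∀ c : Fin n → ℂ, Matrix.vecMul c (γ.derivMatrix a) = ∑ r, c r • γ.deriv r a :=
    fun c => Matrix.vecMul_eq_sum c _
  constructor
  · intro hv
    refine Submodule.span_induction ?_ ?_ ?_ ?_ hv
    · rintro _ ⟨r, rfl⟩
      have hr : (r : ℕ) < n := lt_of_lt_of_le r.2 l.2
      refine ⟨Pi.single ⟨r, hr⟩ 1, fun l' hl' => ?_, ?_⟩
      · refine Pi.single_eq_of_ne (fun h => ?_) _
        subst h
        exact absurd r.2 (by simpa [Fin.lt_def] using hl')
      · rw [Matrix.single_one_vecMul]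
        rfl
    · exact ⟨0, fun _ _ => rfl, (Matrix.zero_vecMul _).symm⟩
    · rintro _ _ - - ⟨c, hc, rfl⟩ ⟨c', hc', rfl⟩
      exact ⟨c + c', fun l' h => by simp [hc l' h, hc' l' h], (Matrix.add_vecMul _ _ _).symm⟩
    · rintro b _ - ⟨c, hc, rfl⟩
      exact ⟨b • c, fun l' h => by simp [hc l' h], (Matrix.smul_vecMul _ _ _).symm⟩
  · rintro ⟨c, hc, rfl⟩
    rw [hsum]
    refine Submodule.sum_mem _ fun r _ => ?_
    by_cases hr : l < r
    · simp [hc r hr]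
    · exact Submodule.smul_mem _ _ (Submodule.subset_span ⟨⟨r, by
        simp only [Fin.lt_def] at hr; omega⟩, rfl⟩)

/-- Invertibility of `g` need not be demanded: the row space of `M` has dimension `k` and lies in
that of `A * γ.derivMatrix a`, so the two agree. -/
theorem mem_osculatingSchubertVariety_iff {γ : RationalNormalCurve n} {α : SchubertCondition k n}
    {a : OnePoint ℂ} {H : Gr k n} {M : Matrix (Fin k) (Fin n) ℂ} (hM : rowSpace M = H.1) :
    H ∈ osculatingSchubertVariety γ α a ↔
      ∃ (g : Matrix (Fin k) (Fin k) ℂ) (A : Matrix (Fin k) (Fin n) ℂ),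
        (∀ j l, α j < l → A j l = 0) ∧ M = g * A * γ.derivMatrix a := by
  rw [osculatingSchubertVariety, mem_schubertVariety_iff (γ.osculatingFlag_mono a)]
  constructor
  · rintro ⟨M', hM', h⟩
    obtain ⟨g, -, hg⟩ := exists_eq_mul_of_rowSpace_eq hM' hM
    choose c hc hc' using fun i => RationalNormalCurve.mem_osculatingFlag_iff.1 (h i)
    refine ⟨g, Matrix.of c, hc, ?_⟩
    rw [hg, Matrix.mul_assoc]
    congr 1
    funext i
    exact (hc' i).trans (Matrix.mul_apply_eq_vecMul _ _ _).symm
  · rintro ⟨g, A, hA, h⟩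
    refine ⟨A * γ.derivMatrix a, ?_, fun i => RationalNormalCurve.mem_osculatingFlag_iff.2
      ⟨A i, hA i, Matrix.mul_apply_eq_vecMul _ _ _⟩⟩
    refine (Submodule.eq_of_le_of_finrank_le ?_ ?_).symm
    · rw [← hM, h, Matrix.mul_assoc]
      exact rowSpace_mul_le _ _
    · rw [H.2]
      exact (finrank_range_le_card _).trans_eq (Fintype.card_fin k)

/-- The generic family of `k × n` matrices. -/
def genericMatrix (k n : ℕ) {ι : Type} (i : ι) :
    Matrix (Fin k) (Fin n) (MvPolynomial (ι × Fin k × Fin n) ℂ) :=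
  Matrix.of fun r s => X (i, r, s)

/-- The family of matrices with the given entries. -/
def matrixOf (z : ι × Fin k × Fin n → ℂ) (i : ι) : Matrix (Fin k) (Fin n) ℂ :=
  Matrix.of fun r s => z (i, r, s)

/-- The determinant of the product of a generic matrix and a constant one. -/
def genericDet (i : ι) (D : Matrix (Fin n) (Fin k) ℂ) : MvPolynomial (ι × Fin k × Fin n) ℂ :=
  let D' : Matrix (Fin n) (Fin k) (MvPolynomial (ι × Fin k × Fin n) ℂ) := D.map C
  (genericMatrix k n i * D').det

theorem eval_genericDet (z : ι × Fin k × Fin n → ℂ) (i : ι) (D : Matrix (Fin n) (Fin k) ℂ) :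
    eval z (genericDet i D) = (matrixOf z i * D).det := by
  rw [genericDet, RingHom.map_det]
  congr 1
  ext r s
  simp [Matrix.mul_apply, genericMatrix, matrixOf]

theorem stiefelMap_apply_eval (E : ι → Matrix (Fin n) (Fin n) ℂ)
    (G : ι → Matrix (Fin k) (Fin k) ℂ) (A : ι → Matrix (Fin k) (Fin n) ℂ)
    {z : ι × Fin k × Fin n → ℂ} (hz : ∀ i, matrixOf z i = G i * A i * E i)
    (p : MvPolynomial (ι × Fin k × Fin n) ℂ) : stiefelMap E G A p = eval z p := by
  have : stiefelMap E G A = aeval z := algHom_ext fun x => by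
    simp only [stiefelMap, aeval_X]
    exact (congrFun (congrFun (hz x.1) x.2.1) x.2.2).symm
  rw [this]
  rfl

theorem eval_eq_zero_of_mem_ker {E : ι → Matrix (Fin n) (Fin n) ℂ}
    {α : ι → SchubertCondition k n} {z : ι × Fin k × Fin n → ℂ}
    (hz : ∀ i, ∃ (g : Matrix (Fin k) (Fin k) ℂ) (A : Matrix (Fin k) (Fin n) ℂ),
      (∀ j l, α i j < l → A j l = 0) ∧ matrixOf z i = g * A * E i)
    {p : MvPolynomial (ι × Fin k × Fin n) ℂ}
    (hp : p ∈ RingHom.ker (stiefelMap E genericSquare (genericEchelon α))) : eval z p = 0 := by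
  choose g A hA hM using hz
  let ρ : MvPolynomial (EchelonVar k n ι) ℂ →ₐ[ℂ] ℂ :=
    aeval fun x => Sum.elim (fun y => g x.1 y.1 y.2) (fun y => A x.1 y.1 y.2) x.2
  have hG : (fun i => (genericSquare i).map ρ) = g := by
    funext i
    ext1 r s
    simp [genericSquare, ρ]
  have hA' : (fun i => (genericEchelon α i).map ρ) = A := by
    funext i
    ext1 j l
    simp only [genericEchelon, Matrix.map_apply, Matrix.of_apply]
    split_ifs with h
    · simp [ρ]
    · rw [map_zero, hA i j l (not_le.1 h)]
  have h := comp_stiefelMap ρ E genericSquare (genericEchelon α)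
  rw [hG, hA'] at h
  rw [← stiefelMap_apply_eval E g A hM, ← h, AlgHom.comp_apply, RingHom.mem_ker.1 hp, map_zero]

/-- The zeros of the kernel form the closure of the family, which may be larger than its image. A
linear form separating `H` from the Schubert variety vanishes on the whole family: a member either
has determinant zero or has rank `k` and lies in the variety. So the form belongs to the kernel. -/
theorem mem_osculatingSchubertVariety_of_eval_eq_zero {γ : RationalNormalCurve n}
    {α : ι → SchubertCondition k n} {a : ι → OnePoint ℂ} {z : ι × Fin k × Fin n → ℂ}
    (hz : ∀ p ∈ RingHom.ker (stiefelMap (fun i => γ.derivMatrix (a i)) genericSquare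
      (genericEchelon α)), eval z p = 0) {i : ι} {H : Gr k n} (hH : rowSpace (matrixOf z i) = H.1) :
    H ∈ osculatingSchubertVariety γ (α i) (a i) := by
  by_contra hnot
  obtain ⟨D, hD, hD'⟩ := exists_det_of_notMem_schubertVariety hnot hH
  refine hD ((eval_genericDet z i D).symm.trans (hz _ ?_))
  rw [RingHom.mem_ker]
  refine MvPolynomial.funext fun v => ?_
  rw [map_zero]
  let E := fun i => γ.derivMatrix (a i)
  let w : ι × Fin k × Fin n → ℂ := fun x =>
    eval v (stiefelMap E genericSquare (genericEchelon α) (X x))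
  let G' : ι → Matrix (Fin k) (Fin k) ℂ := fun i => (genericSquare i).map (aeval (R := ℂ) v)
  let A' : ι → Matrix (Fin k) (Fin n) ℂ := fun i => (genericEchelon α i).map (aeval (R := ℂ) v)
  have hcomp := comp_stiefelMap (aeval (R := ℂ) v) E genericSquare (genericEchelon α)
  have hw : ∀ i, matrixOf w i = G' i * A' i * E i := fun i => by
    ext r s
    have := congrArg (fun f => f (X (i, r, s))) hcomp
    refine this.trans ?_
    simp only [stiefelMap, aeval_X]
    rfl
  have h1 : eval v (stiefelMap E genericSquare (genericEchelon α)
      (genericDet i D)) = (matrixOf w i * D).det := by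
    rw [← eval_genericDet, ← stiefelMap_apply_eval E G' A' hw]
    exact congrArg (fun f => f (genericDet i D)) hcomp
  refine h1.trans ?_
  by_contra hne
  have hli := linearIndependent_of_det_mul_ne_zero hne
  let H' : Gr k n := ⟨rowSpace (matrixOf w i), finrank_rowSpace hli⟩
  refine hne (hD' H' ((mem_osculatingSchubertVariety_iff (H := H') rfl).2
    ⟨G' i, A' i, fun j l hjl => ?_, hw i⟩) _ rfl)
  simp [A', genericEchelon, not_le.2 hjl]

/-- In the coordinate ring of the zeros of `P`, the maximal ideal of `z` has height at least `d`,
and the equations `S` through `z` cost at most `e`. -/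
theorem exists_ltSeries_of_le_trdeg {σ : Type} [Finite σ] {P : Ideal (MvPolynomial σ ℂ)}
    [P.IsPrime] {d e : ℕ} (hd : (d : Cardinal) ≤ Algebra.trdeg ℂ (MvPolynomial σ ℂ ⧸ P))
    {z : σ → ℂ} (hz : ∀ p ∈ P, eval z p = 0) {S : Set (MvPolynomial σ ℂ)}
    (hS : ∀ p ∈ S, eval z p = 0) (he : S.encard ≤ e) :
    ∃ l : LTSeries (PrimeSpectrum (MvPolynomial σ ℂ)), d ≤ l.length + e ∧
      ∀ j, P ≤ (l j).asIdeal ∧ S ⊆ (l j).asIdeal := by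
  let π := Ideal.Quotient.mk P
  let φ : MvPolynomial σ ℂ ⧸ P →+* ℂ := Ideal.Quotient.lift P (eval z) hz
  have hφ : Function.Surjective φ := fun c => ⟨π (C c), by simp [φ, π]⟩
  have : (RingHom.ker φ).IsMaximal := RingHom.ker_isMaximal_of_surjective φ hφ
  obtain ⟨l, hl, hl'⟩ := exists_ltSeries_of_le_height (RingHom.ker φ) (S := π '' S) (by
    rintro _ ⟨p, hp, rfl⟩
    exact hS p hp) (trdeg_le_height_of_isMaximal hd (RingHom.ker φ))
    ((Set.encard_image_le _ _).trans he)
  have hinj : Function.Injective (PrimeSpectrum.comap π) :=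
    PrimeSpectrum.comap_injective_of_surjective π Ideal.Quotient.mk_surjective
  have hmono : StrictMono (PrimeSpectrum.comap π) :=
    Monotone.strictMono_of_injective (fun _ _ h => Ideal.comap_mono h) hinj
  refine ⟨l.map _ hmono, hl, fun j => ⟨?_, fun p hp => hl' j ⟨p, hp, rfl⟩⟩⟩
  intro p hp
  change π p ∈ (l j).asIdeal
  rw [Ideal.Quotient.eq_zero_iff_mem.2 hp]
  exact zero_mem _

end OscSchubert

end

/-! ### From chains of primes to chains of closed sets in the Grassmannian. -/

noncomputable section
namespace OscSchubert
open MvPolynomial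

variable {k n : ℕ} {ι : Type}

/-- Homogenization with respect to `L₀`: summands of different degrees are balanced by powers of
`L₀`, which is `1` on the chart considered. -/
theorem exists_isHomogeneous_eval_eq {σ τ R : Type*} [CommRing R] {L₀ : MvPolynomial τ R}
    {L : σ → MvPolynomial τ R} (hL₀ : L₀.IsHomogeneous 1) (hL : ∀ t, (L t).IsHomogeneous 1)
    (f : MvPolynomial σ R) : ∃ (d : ℕ) (p : MvPolynomial τ R), p.IsHomogeneous d ∧
      ∀ v, eval v L₀ = 1 → eval v p = eval (fun t => eval v (L t)) f := by
  induction f using MvPolynomial.induction_on with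
  | C c => exact ⟨0, C c, isHomogeneous_C _ _, by simp⟩
  | add f g hf hg =>
    obtain ⟨d, p, hp, hpf⟩ := hf
    obtain ⟨e, q, hq, hqg⟩ := hg
    refine ⟨d + e, p * L₀ ^ e + L₀ ^ d * q, ?_, fun v hv => by simp [hv, hpf v hv, hqg v hv]⟩
    exact (hp.mul (by simpa using hL₀.pow e)).add ((by simpa using hL₀.pow d :
      (L₀ ^ d).IsHomogeneous d).mul hq)
  | mul_X f t hf =>
    obtain ⟨d, p, hp, hpf⟩ := hf
    exact ⟨d + 1, p * L t, hp.mul (hL t), fun v hv => by simp [hpf v hv]⟩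

/-- On the chart `M * D = 1` the entries of `M` are linear forms in the Plücker coordinates, by
Cramer's rule. -/
theorem det_mul_updateCol_single {M : Matrix (Fin k) (Fin n) ℂ} {D : Matrix (Fin n) (Fin k) ℂ}
    (h : M * D = 1) (r : Fin k) (s : Fin n) :
    (M * D.updateCol r (Pi.single s 1)).det = M r s := by
  rw [Matrix.mul_updateCol, h, ← Matrix.cramer_apply, Matrix.cramer_one, Matrix.mulVec_single_one]
  rfl

/-- The polynomial in the entries of the generic matrix `i` which is obtained by substituting its
maximal minors in `p`. -/
def substMinors (i : ι) (p : MvPolynomial (Fin k ↪o Fin n) ℂ) :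
    MvPolynomial (ι × Fin k × Fin n) ℂ :=
  aeval (fun β : Fin k ↪o Fin n => ((genericMatrix k n i).submatrix id β).det) p

theorem eval_substMinors (z : ι × Fin k × Fin n → ℂ) (i : ι)
    (p : MvPolynomial (Fin k ↪o Fin n) ℂ) :
    eval z (substMinors i p) = eval (maxMinors (matrixOf z i)) p := by
  have : ((aeval z).comp (aeval fun β : Fin k ↪o Fin n =>
      ((genericMatrix k n i).submatrix id β).det) : MvPolynomial (Fin k ↪o Fin n) ℂ →ₐ[ℂ] ℂ) =
      aeval (maxMinors (matrixOf z i)) := by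
    refine algHom_ext fun β => ?_
    rw [AlgHom.comp_apply, aeval_X, aeval_X, AlgHom.map_det, maxMinors]
    congr 1
    ext r s
    simp [genericMatrix, matrixOf]
  exact congrArg (fun f => f p) this

/-- The set of the `k`-planes which are the row spaces of the matrices `i` in the families on which
`q` vanishes. -/
def rowSpaceLocus (q : Ideal (MvPolynomial (ι × Fin k × Fin n) ℂ)) (i : ι) : Set (Gr k n) :=
  {H | ∃ z ∈ zeroLocus ℂ q, rowSpace (matrixOf z i) = H.1}

theorem exists_eval_ne_zero_of_notMem {σ : Type*} [Finite σ] {q : Ideal (MvPolynomial σ ℂ)}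
    [q.IsPrime] {f : MvPolynomial σ ℂ} (hf : f ∉ q) : ∃ z ∈ zeroLocus ℂ q, eval z f ≠ 0 := by
  by_contra! h
  rw [← IsPrime.vanishingIdeal_zeroLocus (K := ℂ) q] at hf
  exact hf fun z hz => h z hz

/-- At the zeros of `q`, the matrix `i` is a left inverse of `D`. -/
def IsNormalized (q : Ideal (MvPolynomial (ι × Fin k × Fin n) ℂ)) (i : ι)
    (D : Matrix (Fin n) (Fin k) ℂ) : Prop :=
  ∀ z ∈ zeroLocus ℂ q, matrixOf z i * D = 1

theorem IsNormalized.exists_rowSpace_eq {q : Ideal (MvPolynomial (ι × Fin k × Fin n) ℂ)} {i : ι}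
    {D : Matrix (Fin n) (Fin k) ℂ} (hq : IsNormalized q i D) {z : ι × Fin k × Fin n → ℂ}
    (hz : z ∈ zeroLocus ℂ q) : ∃ H : Gr k n, rowSpace (matrixOf z i) = H.1 := by
  have : (matrixOf z i * D).det ≠ 0 := by
    rw [hq z hz, Matrix.det_one]
    exact one_ne_zero
  exact ⟨⟨_, finrank_rowSpace (linearIndependent_of_det_mul_ne_zero this)⟩, rfl⟩

theorem IsNormalized.isIrreducible [Finite ι] {q : Ideal (MvPolynomial (ι × Fin k × Fin n) ℂ)}
    [hp : q.IsPrime] {i : ι} {D : Matrix (Fin n) (Fin k) ℂ} (hq : IsNormalized q i D) :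
    IsIrreducible (rowSpaceLocus q i) := by
  constructor
  · obtain ⟨z, hz, -⟩ := exists_eval_ne_zero_of_notMem (f := 1) fun h =>
      hp.ne_top ((Ideal.eq_top_iff_one q).2 h)
    obtain ⟨H, hH⟩ := hq.exists_rowSpace_eq hz
    exact ⟨H, z, hz, hH⟩
  -- An open set that meets the locus contains the row spaces at all zeros of `q` where some `f ∉ q`
  -- is nonzero. For two open sets, the product of the two polynomials is again outside the prime
  -- `q`.
  · have key : ∀ U : Set (Gr k n), IsOpen U → (rowSpaceLocus q i ∩ U).Nonempty →
        ∃ f ∉ q, ∀ z ∈ zeroLocus ℂ q, eval z f ≠ 0 →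
          ∀ H : Gr k n, rowSpace (matrixOf z i) = H.1 → H ∈ U := by
      rintro U hU ⟨H, ⟨z, hz, hzH⟩, hHU⟩
      obtain ⟨d, p, hp, hHp, hpU⟩ := Gr.exists_nonvanishing_subset hU hHU
      refine ⟨substMinors i p, fun hmem => ?_, fun w _ hw H' hwH' => hpU ?_⟩
      · exact (Gr.mem_nonvanishing_iff hp hzH).1 hHp
          ((eval_substMinors z i p).symm.trans (hz _ hmem))
      · exact (Gr.mem_nonvanishing_iff hp hwH').2 (by rwa [eval_substMinors] at hw)
    intro U V hU hV hU' hV'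
    obtain ⟨f, hf, hfU⟩ := key U hU hU'
    obtain ⟨g, hg, hgV⟩ := key V hV hV'
    obtain ⟨z, hz, hne⟩ := exists_eval_ne_zero_of_notMem (f := f * g) fun h =>
      (hp.mem_or_mem h).elim hf hg
    rw [map_mul] at hne
    obtain ⟨H, hH⟩ := hq.exists_rowSpace_eq hz
    exact ⟨H, ⟨z, hz, hH⟩, hfU z hz (left_ne_zero_of_mul hne) H hH,
      hgV z hz (right_ne_zero_of_mul hne) H hH⟩

/-- Take `f` in `q'` but not in `q`. Since all matrices of a family agree and are normalized, `f` is
a function of the plane, given on the chart by a homogeneous polynomial in the Plücker coordinates.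
It separates the two closures. -/
theorem IsNormalized.closure_lt [Finite ι] {q q' : Ideal (MvPolynomial (ι × Fin k × Fin n) ℂ)}
    [q.IsPrime] {i : ι} {D : Matrix (Fin n) (Fin k) ℂ} (hq : IsNormalized q i D)
    (hconst : ∀ z ∈ zeroLocus ℂ q, ∀ j, matrixOf z j = matrixOf z i) (h : q < q') :
    closure (rowSpaceLocus q' i) ⊂ closure (rowSpaceLocus q i) := by
  have hle : zeroLocus ℂ q' ⊆ zeroLocus ℂ q := zeroLocus_anti_mono h.le
  obtain ⟨f, hf', hf⟩ := SetLike.exists_of_lt h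
  obtain ⟨d, p, hp, hpf⟩ := exists_isHomogeneous_eval_eq (isHomogeneous_pluckerForm D)
    (fun t : ι × Fin k × Fin n =>
      isHomogeneous_pluckerForm (D.updateCol t.2.1 (Pi.single t.2.2 1))) f
  have heval : ∀ z ∈ zeroLocus ℂ q, eval (maxMinors (matrixOf z i)) p = eval z f := fun z hz => by
    rw [hpf _ (by rw [eval_pluckerForm, hq z hz, Matrix.det_one])]
    congr 2
    funext t
    rw [eval_pluckerForm, det_mul_updateCol_single (hq z hz), ← hconst z hz t.1]
    rfl
  refine ⟨closure_mono fun H ⟨z, hz, hzH⟩ => ⟨z, hle hz, hzH⟩, fun hsub => ?_⟩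
  obtain ⟨z, hz, hne⟩ := exists_eval_ne_zero_of_notMem hf
  obtain ⟨H, hH⟩ := hq.exists_rowSpace_eq hz
  have hHc : H ∈ closure (rowSpaceLocus q' i) := hsub (subset_closure ⟨z, hz, hH⟩)
  obtain ⟨H', hH'p, w, hw, hwH'⟩ := mem_closure_iff.1 hHc _ (Gr.isOpen_nonvanishing hp)
    ((Gr.mem_nonvanishing_iff hp hH).2 (by rwa [heval z hz]))
  exact (Gr.mem_nonvanishing_iff hp hwH').1 hH'p ((heval w (hle hw)).trans (hw f hf'))

theorem exists_ltSeries_isNormalized [Fintype ι] (i₀ : ι)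
    {P : Ideal (MvPolynomial (ι × Fin k × Fin n) ℂ)} [P.IsPrime] {d : ℕ}
    (hd : (d : Cardinal) ≤ Algebra.trdeg ℂ (MvPolynomial (ι × Fin k × Fin n) ℂ ⧸ P))
    {M : Matrix (Fin k) (Fin n) ℂ} (hM : LinearIndependent ℂ M.row)
    (hMP : ∀ p ∈ P, eval (fun x => M x.2.1 x.2.2) p = 0) :
    ∃ (D : Matrix (Fin n) (Fin k) ℂ)
      (l : LTSeries (PrimeSpectrum (MvPolynomial (ι × Fin k × Fin n) ℂ))),
      d + k * n ≤ l.length + Fintype.card ι * (k * n) + k * k ∧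
      ∀ j, P ≤ (l j).asIdeal ∧ IsNormalized (l j).asIdeal i₀ D ∧
        ∀ z ∈ zeroLocus ℂ (l j).asIdeal, ∀ i, matrixOf z i = matrixOf z i₀ := by
  classical
  obtain ⟨D, hD⟩ := exists_rightInverse hM
  let z : ι × Fin k × Fin n → ℂ := fun x => M x.2.1 x.2.2
  -- The first group of equations cuts out the diagonal, the second imposes that matrix `i₀` times
  -- `D` is the identity.
  let f : {i : ι // i ≠ i₀} × Fin k × Fin n ⊕ Fin k × Fin k →
      MvPolynomial (ι × Fin k × Fin n) ℂ :=
    Sum.elim (fun x => X (x.1.1, x.2) - X (i₀, x.2))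
      (fun y => ∑ s, X (i₀, y.1, s) * C (D s y.2) - C ((1 : Matrix (Fin k) (Fin k) ℂ) y.1 y.2))
  have hf : ∀ w, (∀ x, eval w (f x) = 0) →
      (∀ i, matrixOf w i = matrixOf w i₀) ∧ matrixOf w i₀ * D = 1 := fun w hw => by
    constructor
    · intro i
      by_cases hi : i = i₀
      · rw [hi]
      · ext r s
        have h : w (i, r, s) = w (i₀, r, s) := by
          simpa [f, sub_eq_zero] using hw (Sum.inl (⟨i, hi⟩, r, s))
        exact h
    · ext r s
      have := hw (Sum.inr (r, s))
      simpa [f, sub_eq_zero, Matrix.mul_apply, matrixOf] using this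
  have hzf : ∀ x, eval z (f x) = 0 := by
    rintro (x | ⟨r, s⟩)
    · simp [f, z]
    · have := congrFun (congrFun hD r) s
      simp only [Matrix.mul_apply] at this
      simp [f, z, this]
  obtain ⟨l, hl, hl'⟩ := exists_ltSeries_of_le_trdeg hd hMP (S := Set.range f)
    (e := (Fintype.card ι - 1) * (k * n) + k * k) (by rintro _ ⟨x, rfl⟩; exact hzf x) (by
      rw [← Set.image_univ]
      refine (Set.encard_image_le _ _).trans ?_
      rw [Set.encard_univ, ENat.card_eq_coe_fintype_card]
      simp [Fintype.card_subtype_compl])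
  refine ⟨D, l, ?_, fun j => ⟨(hl' j).1, fun w hw => (hf w fun x => ?_).2,
    fun w hw => (hf w fun x => ?_).1⟩⟩
  · have hpos : 0 < Fintype.card ι := Fintype.card_pos_iff.2 ⟨i₀⟩
    obtain ⟨c, hc⟩ := Nat.exists_eq_succ_of_ne_zero hpos.ne'
    rw [hc] at hl ⊢
    simp only [Nat.succ_eq_add_one, Nat.add_sub_cancel] at hl
    rw [Nat.succ_eq_add_one, add_mul, one_mul]
    omega
  · exact hw _ ((hl' j).2 ⟨x, rfl⟩)
  · exact hw _ ((hl' j).2 ⟨x, rfl⟩)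

theorem exists_ltSeries_irreducibleCloseds [Fintype ι] [Nonempty ι] (hkn : k ≤ n)
    (γ : RationalNormalCurve n) {α : ι → SchubertCondition k n} {a : ι → OnePoint ℂ}
    (hne : (⋂ i, osculatingSchubertVariety γ (α i) (a i)).Nonempty) :
    ∃ l : LTSeries (TopologicalSpace.IrreducibleCloseds (Gr k n)),
      (l.last : Set (Gr k n)) ⊆ ⋂ i, osculatingSchubertVariety γ (α i) (a i) ∧
        k * (n - k) ≤ l.length + ∑ i, (α i).size := by
  obtain ⟨i₀⟩ := ‹Nonempty ι›
  obtain ⟨H, hH⟩ := hne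
  rw [Set.mem_iInter] at hH
  obtain ⟨M, hM⟩ := exists_rowSpace_eq H
  let E : ι → Matrix (Fin n) (Fin n) ℂ := fun i => γ.derivMatrix (a i)
  let P := RingHom.ker (stiefelMap E genericSquare (genericEchelon α))
  have hP : P.IsPrime := RingHom.ker_isPrime _
  obtain ⟨D, l, hl, hl'⟩ := exists_ltSeries_isNormalized i₀
    (card_reducedVar_le_trdeg (fun i => γ.isUnit_det_derivMatrix (a i)) α)
    (linearIndependent_of_rowSpace hM) fun p hp => eval_eq_zero_of_mem_ker (fun i =>
      (mem_osculatingSchubertVariety_iff (M := matrixOf (fun x => M x.2.1 x.2.2) i) hM).1 (hH i)) hp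
  have hclosed : IsClosed (⋂ i, osculatingSchubertVariety γ (α i) (a i)) :=
    isClosed_iInter fun i => isClosed_schubertVariety _ _
  -- Reversed, since larger primes have smaller loci. Every locus lies in the intersection because
  -- every prime of the chain contains `P`.
  refine ⟨⟨l.length, fun j => ⟨closure (rowSpaceLocus (l j.rev).asIdeal i₀),
    (hl' _).2.1.isIrreducible.closure, isClosed_closure⟩, fun j => ?_⟩, ?_, ?_⟩
  · exact (hl' _).2.1.closure_lt (hl' _).2.2 (l.strictMono (Fin.rev_lt_rev.2 j.castSucc_lt_succ))
  · refine closure_minimal ?_ hclosed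
    rintro H' ⟨z, hz, hzH'⟩
    refine Set.mem_iInter.2 fun i => mem_osculatingSchubertVariety_of_eval_eq_zero
      (fun p hp => hz p ((hl' _).1 hp)) ?_
    rw [(hl' _).2.2 z hz i, hzH']
  · have := card_reducedVar hkn α
    have h3 : k * k + k * (n - k) = k * n := by
      rw [← mul_add]
      congr 1
      omega
    change _ ≤ l.length + _
    omega

end OscSchubert

end

/-! ### Krull dimensions and the theorem. -/

noncomputable section
namespace OscSchubert
open TopologicalSpace

variable {k n : ℕ} {ι : Type}

/-- For closed `X`, the irreducible closed subsets of `X` are those of `T` contained in `X`, so all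
chains can be handled in the ambient space. -/
theorem natCast_le_topologicalKrullDim_iff {T : Type*} [TopologicalSpace T] {X : Set T}
    (hX : IsClosed X) {d : ℕ} : (d : WithBot ℕ∞) ≤ topologicalKrullDim X ↔
      ∃ l : LTSeries (IrreducibleCloseds T), l.length = d ∧ (l.last : Set T) ⊆ X := by
  rw [topologicalKrullDim, Order.le_krullDim_iff]
  constructor
  · rintro ⟨l, hl⟩
    refine ⟨l.map _ (IrreducibleCloseds.map_strictMono_of_isInducing (f := ((↑) : X → T))
      Topology.IsInducing.subtypeVal), hl, ?_⟩
    rw [LTSeries.last_map]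
    refine closure_minimal ?_ hX
    rintro _ ⟨x, -, rfl⟩
    exact x.2
  · rintro ⟨l, hl, hlX⟩
    have hsub : ∀ j, (l j : Set T) ⊆ X := fun j =>
      Set.Subset.trans (show l j ≤ l.last from LTSeries.monotone l (Fin.le_last j)) hlX
    have himg : ∀ j, ((↑) : X → T) '' (((↑) : X → T) ⁻¹' (l j : Set T)) = l j := fun j => by
      rw [Subtype.image_preimage_coe, Set.inter_eq_right.2 (hsub j)]
    refine ⟨⟨l.length, fun j => ⟨((↑) : X → T) ⁻¹' (l j : Set T), ?_,
      (l j).isClosed.preimage continuous_subtype_val⟩, fun j => ?_⟩, hl⟩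
    · constructor
      · obtain ⟨x, hx⟩ := (l j).isIrreducible.nonempty
        exact ⟨⟨x, hsub j hx⟩, hx⟩
      · rintro _ _ ⟨U, hU, rfl⟩ ⟨V, hV, rfl⟩ ⟨x, hx, hxU⟩ ⟨y, hy, hyV⟩
        obtain ⟨z, hz, hzUV⟩ :=
          (l j).isIrreducible.isPreirreducible U V hU hV ⟨x, hx, hxU⟩ ⟨y, hy, hyV⟩
        exact ⟨⟨z, hsub j hz⟩, hz, hzUV⟩
    · have hlt : l j.castSucc < l j.succ := l.step j
      refine lt_of_le_not_ge (Set.preimage_mono hlt.le) fun hge => hlt.not_ge ?_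
      have := Set.image_mono (f := ((↑) : X → T)) hge
      exact (himg j.succ).symm.subset.trans (this.trans (himg _).subset)

theorem topologicalKrullDim_iInter_osculatingSchubertVariety [Fintype ι] [Nonempty ι] (hk : 0 < k)
    (hkn : k ≤ n) (γ : RationalNormalCurve n) {α : ι → SchubertCondition k n}
    {a : ι → OnePoint ℂ} (ha : Function.Injective a)
    (hne : (⋂ i, osculatingSchubertVariety γ (α i) (a i)).Nonempty) :
    ∃ d : ℕ, topologicalKrullDim ↥(⋂ i, osculatingSchubertVariety γ (α i) (a i)) = d ∧
      d + ∑ i, (α i).size = k * (n - k) := by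
  have hclosed : IsClosed (⋂ i, osculatingSchubertVariety γ (α i) (a i)) :=
    isClosed_iInter fun i => isClosed_schubertVariety _ _
  obtain ⟨l, hl, hle⟩ := exists_ltSeries_irreducibleCloseds hkn γ hne
  have hle' := length_add_sum_size_le hk hkn γ ha l hl
  refine ⟨l.length, le_antisymm ?_
    ((natCast_le_topologicalKrullDim_iff hclosed).2 ⟨l, rfl, hl⟩), by omega⟩
  refine iSup_le fun p => ?_
  obtain ⟨l', hl', hl'X⟩ := (natCast_le_topologicalKrullDim_iff hclosed (d := p.length)).1
    (Order.LTSeries.length_le_krullDim p)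
  have := length_add_sum_size_le hk hkn γ ha l' hl'X
  exact_mod_cast (by omega : p.length ≤ l.length)

/-- The Grassmannian is itself an osculating Schubert variety, for the trivial condition at one
point. The set `X` only serves to supply a point. -/
theorem topologicalKrullDim_gr (hk : 0 < k) (hkn : k ≤ n) (γ : RationalNormalCurve n)
    {X : Set (Gr k n)} (hX : X.Nonempty) :
    topologicalKrullDim (Gr k n) = ((k * (n - k) : ℕ) : WithBot ℕ∞) ∧
      topologicalKrullDim (Set.univ : Set (Gr k n)) = ((k * (n - k) : ℕ) : WithBot ℕ∞) := by
  have huniv : (⋂ _ : Unit, osculatingSchubertVariety (k := k) γ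
      (SchubertCondition.trivial hkn) OnePoint.infty) = Set.univ := by
    simp [osculatingSchubertVariety_trivial]
  obtain ⟨d, hd, hd'⟩ := topologicalKrullDim_iInter_osculatingSchubertVariety hk hkn γ
    (α := fun _ : Unit => SchubertCondition.trivial hkn) (a := fun _ => OnePoint.infty)
    (fun _ _ _ => rfl) (by rw [huniv]; exact hX.mono (Set.subset_univ _))
  rw [huniv] at hd
  have hd0 : d = k * (n - k) := by simpa [SchubertCondition.size_trivial] using hd'
  subst hd0
  exact ⟨((Homeomorph.Set.univ (Gr k n)).isHomeomorph.topologicalKrullDim_eq _).symm.trans hd, hd⟩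

end OscSchubert

end

theorem mainTheorem1 (k n : ℕ) (hk : 0 < k) (hkn : k < n)
    (γ : OscSchubert.RationalNormalCurve n)
    (m : ℕ) (α : Fin m → OscSchubert.SchubertCondition k n)
    (a : Fin m → OnePoint ℂ) (ha : Function.Injective a)
    (hne : (⋂ i : Fin m, OscSchubert.osculatingSchubertVariety γ (α i) (a i)).Nonempty) :
    OscSchubert.HasCodim
      (⋂ i : Fin m, OscSchubert.osculatingSchubertVariety γ (α i) (a i))
      (∑ i : Fin m, (α i).size) := by
  obtain ⟨hgr, huniv⟩ := OscSchubert.topologicalKrullDim_gr hk hkn.le γ hne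
  rcases isEmpty_or_nonempty (Fin m) with hm | hm
  -- With no conditions the intersection is the whole Grassmannian. This case is separate because
  -- the lower bound singles out an index.
  · refine ⟨k * (n - k), ?_, ?_⟩
    · rwa [Set.iInter_of_empty]
    · rwa [Finset.univ_eq_empty, Finset.sum_empty, add_zero]
  · obtain ⟨d, hd, hd'⟩ :=
      OscSchubert.topologicalKrullDim_iInter_osculatingSchubertVariety hk hkn.le γ ha hne
    exact ⟨d, hd, by rw [hd', hgr]⟩
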